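/- Let ordinary variables $x,y,\dots$ and continuation variables $k,l,\dots$ be two disjoint countably infinite sets. The terms $M$ and jumps $J$ of the CCV $\lambda\mu$-calculus are given by $$M ::= x \mid \lambda x.\,M \mid M\,M \mid M\langle x:=M\rangle \mid \mu k.\,J,\qquad J ::= [k]M \mid J\langle x:=M\rangle,$$ where $\lambda x$ binds $x$, $\mu k$ binds $k$, and the let-construct $L\langle x:=M\rangle$ ("let $x=M$ in $L$") binds $x$ in $L$ but not in $M$. Terms and jumps are taken modulo $\alpha$-conversion and modulo the smallest congruence containing the equality axioms $$L\langle x:=M\langle y:=N\rangle\rangle = (L\langle x:=M\rangle)\langle y:=N\rangle\ (y\notin \mathrm{FV}(L)),$$ $$(\mu k.\,J)\langle x:=M\rangle = \mu k.\,(J\langle x:=M\rangle)\ (k\notin \mathrm{FV}(M)),\qquad [k](L\langle x:=M\rangle) = ([k]L)\langle x:=M\rangle,$$ where $L,M,N$ are terms and $J$ is a jump. A term is a value if it is a variable or a $\lambda$-abstraction, and a non-value otherwise. The one-step reduction $\to$ is the closure under all term and jump constructors of the following nine rules, in which $V$ is a value and $z$ is fresh: - $(ad_1)$ $NM\to (zM)\langle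 z:=N\rangle$ if $N$ is a non-value; - $(ad_2)$ $VN\to (Vz)\langle z:=N\rangle$ if $N$ is a non-value; - $(\beta_\lambda)$ $(\lambda x.\,M)V\to M\langle x:=V\rangle$; - $(\beta_{let})$ $M\langle x:=V\rangle\to M\{V/x\}$; - $(\beta_\mu)$ $M\langle x:=\mu k.\,J\rangle\to \mu k.\,J\{[k]\square\mapsto [k](M\langle x:=\square\rangle)\}$ (with $k\notin\mathrm{FV}(M)$, by $\alpha$-conversion); - $(\beta_{jmp})$ $[l]\mu k.\,J\to J\{l/k\}$; - $(\eta_\lambda)$ $\lambda x.\,Vx\to V$ if $x\notin \mathrm{FV}(V)$; - $(\eta_{let})$ $x\langle x:=M\rangle\to M$; - $(\eta_\mu)$ $\mu k.\,[k]M\to M$ if $k\notin \mathrm{FV}(M)$. Substitutions are capture-avoiding, and $J\{[k]\square\mapsto [k](M\langle x:=\square\rangle)\}$ replaces, recursively, every part $[k]Q$ of $J$ with $k$ free by $[k](M\langle x:=Q\rangle)$. Let $\twoheadrightarrow$ be the reflexive transitive closure of $\to$, and let $=_{ccv}$ be the smallest congruence (equivalence relation compatible with all constructors) containing the nine rules.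 **Theorem.** The CCV $\lambda\mu$-calculus has the Church–Rosser property: if $M_1=_{ccv}M_2$, where $M_1,M_2$ are two terms or two jumps, then there is a term (respectively a jump) $N$ with $M_1\twoheadrightarrow N$ and $M_2\twoheadrightarrow N$. -/

import Mathlib

/-! # The CCV `λμ`-calculus

Raw expressions are written with de Bruijn indices, so that `α`-convertible expressions are
literally equal. There are two separate families of indices, one for ordinary variables
(bound by `lam` and `letin`) and one for continuation variables (bound by `mu`); indices that
are not bound stand for free variables. -/

namespace CCV

/-- The two syntactic categories. -/
inductive Cat : Type
  | term
  | jump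

/-- Raw terms `M` and jumps `J`:
`M ::= x | λx.M | M M | M⟨x := M⟩ | μk.J` and `J ::= [k]M | J⟨x := M⟩`.
In `letin L M`, written `L⟨x := M⟩` on paper, the ordinary index `0` is bound in the body `L`
(a term or a jump) and is not bound in the argument `M`. -/
inductive Expr : Cat → Type
  | var (x : ℕ) : Expr Cat.term
  | lam (M : Expr Cat.term) : Expr Cat.term
  | app (M N : Expr Cat.term) : Expr Cat.term
  | letin {s : Cat} (L : Expr s) (M : Expr Cat.term) : Expr s
  | mu (J : Expr Cat.jump) : Expr Cat.term
  | jmp (k : ℕ) (M : Expr Cat.term) : Expr Cat.jump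

namespace Expr

/-- Extend a renaming of indices under a binder. -/
def up (ρ : ℕ → ℕ) : ℕ → ℕ
  | 0 => 0
  | n + 1 => ρ n + 1

/-- Rename the free ordinary variables by `ρ` and the free continuation variables by `κ`. -/
def rename : {s : Cat} → (ℕ → ℕ) → (ℕ → ℕ) → Expr s → Expr s
  | _, ρ, _, var x => var (ρ x)
  | _, ρ, κ, lam M => lam (rename (up ρ) κ M)
  | _, ρ, κ, app M N => app (rename ρ κ M) (rename ρ κ N)
  | _, ρ, κ, letin L M => letin (rename (up ρ) κ L) (rename ρ κ M)
  | _, ρ, κ, mu J => mu (rename ρ (up κ) J)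
  | _, ρ, κ, jmp k M => jmp (κ k) (rename ρ κ M)

/-- Weakening by one fresh ordinary variable, which gets the index `0`. -/
def wkVar {s : Cat} (M : Expr s) : Expr s := rename Nat.succ id M

/-- Weakening by one fresh continuation variable, which gets the index `0`. -/
def wkCont {s : Cat} (M : Expr s) : Expr s := rename id Nat.succ M

/-- Weakening of an expression that lives under one ordinary binder: a fresh ordinary variable
is inserted just outside this binder, so it gets the index `1`. -/
def wkVarUnder {s : Cat} (M : Expr s) : Expr s := rename (up Nat.succ) id M

/-- Extend a substitution for ordinary variables under an ordinary binder. -/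
def upSubst (σ : ℕ → Expr Cat.term) : ℕ → Expr Cat.term
  | 0 => var 0
  | n + 1 => wkVar (σ n)

/-- Capture-avoiding simultaneous substitution for the free ordinary variables. -/
def subst : {s : Cat} → (ℕ → Expr Cat.term) → Expr s → Expr s
  | _, σ, var x => σ x
  | _, σ, lam M => lam (subst (upSubst σ) M)
  | _, σ, app M N => app (subst σ M) (subst σ N)
  | _, σ, letin L M => letin (subst (upSubst σ) L) (subst σ M)
  | _, σ, mu J => mu (subst (fun n => wkCont (σ n)) J)
  | _, σ, jmp k M => jmp k (subst σ M)

/-- The substitution `{V/x}` where `x` is the ordinary variable with index `0`,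
which disappears. -/
def single (V : Expr Cat.term) : ℕ → Expr Cat.term
  | 0 => V
  | n + 1 => var n

/-- `M{V/x}` for the ordinary variable `x` with index `0`. -/
def inst {s : Cat} (M : Expr s) (V : Expr Cat.term) : Expr s := subst (single V) M

/-- The renaming of continuation variables that sends index `0` to `l` and lowers the others. -/
def singleCont (l : ℕ) : ℕ → ℕ
  | 0 => l
  | n + 1 => n

/-- `J{l/k}` for the continuation variable `k` with index `0`. -/
def instCont {s : Cat} (J : Expr s) (l : ℕ) : Expr s := rename id (singleCont l) J

/-- The context substitution `E{[k]□ ↦ [k](L⟨x := □⟩)}`, recursively in the whole of `E`.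
Here `L` lives under the ordinary binder `x` of index `0`. -/
def ctxSubst : {s : Cat} → ℕ → Expr Cat.term → Expr s → Expr s
  | _, _, _, var x => var x
  | _, k, L, lam M => lam (ctxSubst k (wkVarUnder L) M)
  | _, k, L, app M N => app (ctxSubst k L M) (ctxSubst k L N)
  | _, k, L, letin B M => letin (ctxSubst k (wkVarUnder L) B) (ctxSubst k L M)
  | _, k, L, mu J => mu (ctxSubst (k + 1) (wkCont L) J)
  | _, k, L, jmp j M =>
      if j = k then jmp j (letin L (ctxSubst k L M)) else jmp j (ctxSubst k L M)

/-- Values are the variables and the lambda abstractions. -/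
inductive IsValue : Expr Cat.term → Prop
  | var (x : ℕ) : IsValue (var x)
  | lam (M : Expr Cat.term) : IsValue (lam M)

/-- The three equality axioms. The side conditions of freshness are expressed by weakening. -/
inductive Axm : {s : Cat} → Expr s → Expr s → Prop
  /-- `L⟨x := (M⟨y := N⟩)⟩ = (L⟨x := M⟩)⟨y := N⟩`, `y` not free in `L`. -/
  | assoc (L M N : Expr Cat.term) :
      Axm (letin L (letin M N)) (letin (letin (wkVarUnder L) M) N)
  /-- `(μk.J)⟨x := M⟩ = μk.(J⟨x := M⟩)`, `k` not free in `M`. -/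
  | mu_let (J : Expr Cat.jump) (M : Expr Cat.term) :
      Axm (letin (mu J) M) (mu (letin J (wkCont M)))
  /-- `[k](L⟨x := M⟩) = ([k]L)⟨x := M⟩`. -/
  | jmp_let (k : ℕ) (L M : Expr Cat.term) :
      Axm (jmp k (letin L M)) (letin (jmp k L) M)

/-- The identification of expressions: the smallest congruence that contains the equality
axioms. -/
inductive Ident : {s : Cat} → Expr s → Expr s → Prop
  | axm {s : Cat} {A B : Expr s} : Axm A B → Ident A B
  | refl {s : Cat} (A : Expr s) : Ident A A
  | symm {s : Cat} {A B : Expr s} : Ident A B → Ident B A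
  | trans {s : Cat} {A B C : Expr s} : Ident A B → Ident B C → Ident A C
  | lam {M M' : Expr Cat.term} : Ident M M' → Ident (lam M) (lam M')
  | app {M M' N N' : Expr Cat.term} : Ident M M' → Ident N N' → Ident (app M N) (app M' N')
  | letin {s : Cat} {L L' : Expr s} {M M' : Expr Cat.term} :
      Ident L L' → Ident M M' → Ident (letin L M) (letin L' M')
  | mu {J J' : Expr Cat.jump} : Ident J J' → Ident (mu J) (mu J')
  | jmp (k : ℕ) {M M' : Expr Cat.term} : Ident M M' → Ident (jmp k M) (jmp k M')

instance identSetoid (s : Cat) : Setoid (Expr s) where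
  r := Ident
  iseqv := ⟨Ident.refl, Ident.symm, Ident.trans⟩

/-- The nine reduction rules (at the root, between representatives). -/
inductive Rule : {s : Cat} → Expr s → Expr s → Prop
  /-- `N M → (z M)⟨z := N⟩`, `N` a non-value, `z` fresh. -/
  | ad₁ (N M : Expr Cat.term) : ¬ IsValue N →
      Rule (app N M) (letin (app (var 0) (wkVar M)) N)
  /-- `V N → (V z)⟨z := N⟩`, `V` a value, `N` a non-value, `z` fresh. -/
  | ad₂ (V N : Expr Cat.term) : IsValue V → ¬ IsValue N →
      Rule (app V N) (letin (app (wkVar V) (var 0)) N)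
  /-- `(λx.M) V → M⟨x := V⟩`. -/
  | beta_lam (M V : Expr Cat.term) : IsValue V → Rule (app (lam M) V) (letin M V)
  /-- `M⟨x := V⟩ → M{V/x}`. -/
  | beta_let (M V : Expr Cat.term) : IsValue V → Rule (letin M V) (inst M V)
  /-- `M⟨x := μk.J⟩ → μk. J{[k]□ ↦ [k](M⟨x := □⟩)}`. -/
  | beta_mu (M : Expr Cat.term) (J : Expr Cat.jump) :
      Rule (letin M (mu J)) (mu (ctxSubst 0 (wkCont M) J))
  /-- `[l]μk.J → J{l/k}`. -/
  | beta_jmp (l : ℕ) (J : Expr Cat.jump) : Rule (jmp l (mu J)) (instCont J l)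
  /-- `λx.V x → V`, `V` a value, `x` not free in `V`. -/
  | eta_lam (V : Expr Cat.term) : IsValue V → Rule (lam (app (wkVar V) (var 0))) V
  /-- `x⟨x := M⟩ → M`. -/
  | eta_let (M : Expr Cat.term) : Rule (letin (var 0) M) M
  /-- `μk.[k]M → M`, `k` not free in `M`. -/
  | eta_mu (M : Expr Cat.term) : Rule (mu (jmp 0 (wkCont M))) M

end Expr

/-- The terms (`s = Cat.term`) and the jumps (`s = Cat.jump`) of the CCV `λμ`-calculus:
expressions modulo the equality axioms. -/
def Exp (s : Cat) : Type := Quotient (Expr.identSetoid s)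

namespace Exp

/-- The class of a raw expression. -/
def mk {s : Cat} (A : Expr s) : Exp s := Quotient.mk (Expr.identSetoid s) A

/-- Lambda abstraction on classes. -/
def lam : Exp Cat.term → Exp Cat.term :=
  Quotient.map Expr.lam fun _ _ h => Expr.Ident.lam h

/-- Application on classes. -/
def app : Exp Cat.term → Exp Cat.term → Exp Cat.term :=
  Quotient.map₂ Expr.app fun _ _ h _ _ h' => Expr.Ident.app h h'

/-- The let-construct on classes. -/
def letin {s : Cat} : Exp s → Exp Cat.term → Exp s :=
  Quotient.map₂ Expr.letin fun _ _ h _ _ h' => Expr.Ident.letin h h'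

/-- Mu abstraction on classes. -/
def mu : Exp Cat.jump → Exp Cat.term :=
  Quotient.map Expr.mu fun _ _ h => Expr.Ident.mu h

/-- The jumper `[k]` on classes. -/
def jmp (k : ℕ) : Exp Cat.term → Exp Cat.jump :=
  Quotient.map (Expr.jmp k) fun _ _ h => Expr.Ident.jmp k h

end Exp

/-- One-step reduction `A → B`: a rule is applied to a subexpression, everything being read
modulo the equality axioms. -/
inductive Red : {s : Cat} → Exp s → Exp s → Prop
  | rule {s : Cat} {A B : Expr s} : Expr.Rule A B → Red (Exp.mk A) (Exp.mk B)
  | lam {M M' : Exp Cat.term} : Red M M' → Red (Exp.lam M) (Exp.lam M')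
  | app_left {M M' : Exp Cat.term} (N : Exp Cat.term) :
      Red M M' → Red (Exp.app M N) (Exp.app M' N)
  | app_right (M : Exp Cat.term) {N N' : Exp Cat.term} :
      Red N N' → Red (Exp.app M N) (Exp.app M N')
  | let_left {s : Cat} {L L' : Exp s} (M : Exp Cat.term) :
      Red L L' → Red (Exp.letin L M) (Exp.letin L' M)
  | let_right {s : Cat} (L : Exp s) {M M' : Exp Cat.term} :
      Red M M' → Red (Exp.letin L M) (Exp.letin L M')
  | mu {J J' : Exp Cat.jump} : Red J J' → Red (Exp.mu J) (Exp.mu J')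
  | jmp (k : ℕ) {M M' : Exp Cat.term} : Red M M' → Red (Exp.jmp k M) (Exp.jmp k M')

/-- Reduction `A ↠ B` in finitely many (possibly zero) steps. -/
def Reds {s : Cat} : Exp s → Exp s → Prop := Relation.ReflTransGen Red

/-- The CCV equality: the smallest congruence that contains the reduction rules. -/
inductive CcvEq : {s : Cat} → Exp s → Exp s → Prop
  | rule {s : Cat} {A B : Expr s} : Expr.Rule A B → CcvEq (Exp.mk A) (Exp.mk B)
  | refl {s : Cat} (A : Exp s) : CcvEq A A
  | symm {s : Cat} {A B : Exp s} : CcvEq A B → CcvEq B A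
  | trans {s : Cat} {A B C : Exp s} : CcvEq A B → CcvEq B C → CcvEq A C
  | lam {M M' : Exp Cat.term} : CcvEq M M' → CcvEq (Exp.lam M) (Exp.lam M')
  | app {M M' N N' : Exp Cat.term} :
      CcvEq M M' → CcvEq N N' → CcvEq (Exp.app M N) (Exp.app M' N')
  | letin {s : Cat} {L L' : Exp s} {M M' : Exp Cat.term} :
      CcvEq L L' → CcvEq M M' → CcvEq (Exp.letin L M) (Exp.letin L' M')
  | mu {J J' : Exp Cat.jump} : CcvEq J J' → CcvEq (Exp.mu J) (Exp.mu J')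
  | jmp (k : ℕ) {M M' : Exp Cat.term} : CcvEq M M' → CcvEq (Exp.jmp k M) (Exp.jmp k M')

end CCV

/-! The calculus is compared with a simpler one through a CPS translation and a translation back.

The target has values, continuations and commands, with β-rules for returning to a continuation and
for calling a function, and with η-rules. It has no equality axioms and no administrative rules. It
is confluent (`Cps.confluent`): its complete development `dev` has the Z-property, namely `A → B`
implies `B ↠ dev A` and `dev A ↠ dev B`.

The forward translation `cps` sends both sides of an equality axiom to the same command, so it is
defined on classes. It sends the two sides of each reduction rule to convertible commands
(`Expr.Rule.conv`). Hence ccv-equal expressions have translations with a common reduct `Q`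
(`CcvEq.conv`).

The inverse translation `readback` turns a value into a term, a continuation into a jump context
`[k]□` or `J⟨x := □⟩`, and a command into a jump. A jump is made into a term by `muEta`, a
μ-abstraction with η-contraction at the root. Two facts bring `Q` back to the source. Every
expression reduces to the readback of its own translation (`Expr.reds_close_cps`), and target
reductions become source reductions (`Cps.Steps.reds_close`). So both given expressions reduce to
the readback of `Q`.

The delicate point is that `muEta` may erase the very jump in which a step takes place, so `J ↠ J'`
alone does not visibly yield `muEta J ↠ muEta J'`. The relation `Expr.Simulates` strengthens
reduction of jumps just enough to pass through `muEta`, and it is what one target step is shown to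
give. -/

namespace CCV

/-! ### The target calculus: syntax and substitution -/

/-- The three syntactic categories of the target of the CPS translation. -/
inductive CpsSort : Type
  | val
  | cont
  | cmd

/-- The target of the CPS translation. The constructor `lam` binds an ordinary variable and a
continuation variable, and `kont` binds an ordinary variable. -/
inductive Cps : CpsSort → Type
  | var (x : ℕ) : Cps CpsSort.val
  | lam (Q : Cps CpsSort.cmd) : Cps CpsSort.val
  | cvar (k : ℕ) : Cps CpsSort.cont
  | kont (Q : Cps CpsSort.cmd) : Cps CpsSort.cont
  | ret (K : Cps CpsSort.cont) (W : Cps CpsSort.val) : Cps CpsSort.cmd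
  | call (V W : Cps CpsSort.val) (K : Cps CpsSort.cont) : Cps CpsSort.cmd

/-- Extend a sequence by a new first entry. -/
def cons {α : Type*} (a : α) (f : ℕ → α) : ℕ → α
  | 0 => a
  | n + 1 => f n

@[simp] theorem cons_zero {α : Type*} (a : α) (f : ℕ → α) : cons a f 0 = a := rfl

@[simp] theorem cons_succ {α : Type*} (a : α) (f : ℕ → α) (n : ℕ) : cons a f (n + 1) = f n := rfl

namespace Expr

@[simp] theorem up_zero (ρ : ℕ → ℕ) : up ρ 0 = 0 := rfl

@[simp] theorem up_succ (ρ : ℕ → ℕ) (n : ℕ) : up ρ (n + 1) = ρ n + 1 := rfl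

@[simp] theorem up_id : up id = id := by
  funext n; cases n <;> rfl

theorem up_comp (ρ ρ' : ℕ → ℕ) : up ρ ∘ up ρ' = up (ρ ∘ ρ') := by
  funext n; cases n <;> rfl

end Expr

namespace Cps

open CCV.Expr (up up_comp up_id up_zero up_succ)

/-- Simultaneous renaming of ordinary and continuation variables. -/
def rename : {s : CpsSort} → (ℕ → ℕ) → (ℕ → ℕ) → Cps s → Cps s
  | _, r, _, var x => var (r x)
  | _, r, c, lam Q => lam (rename (up r) (up c) Q)
  | _, _, c, cvar k => cvar (c k)
  | _, r, c, kont Q => kont (rename (up r) c Q)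
  | _, r, c, ret K W => ret (rename r c K) (rename r c W)
  | _, r, c, call V W K => call (rename r c V) (rename r c W) (rename r c K)

/-- Simultaneous substitution for ordinary and continuation variables. -/
def subst : {s : CpsSort} → (ℕ → Cps CpsSort.val) → (ℕ → Cps CpsSort.cont) → Cps s → Cps s
  | _, σ, _, var x => σ x
  | _, σ, κ, lam Q =>
      lam (subst (cons (var 0) fun n => rename Nat.succ Nat.succ (σ n))
        (cons (cvar 0) fun n => rename Nat.succ Nat.succ (κ n)) Q)
  | _, _, κ, cvar k => κ k
  | _, σ, κ, kont Q =>
      kont (subst (cons (var 0) fun n => rename Nat.succ id (σ n))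
        (fun n => rename Nat.succ id (κ n)) Q)
  | _, σ, κ, ret K W => ret (subst σ κ K) (subst σ κ W)
  | _, σ, κ, call V W K => call (subst σ κ V) (subst σ κ W) (subst σ κ K)

theorem rename_rename {s : CpsSort} (A : Cps s) (r r' c c' : ℕ → ℕ) :
    rename r c (rename r' c' A) = rename (r ∘ r') (c ∘ c') A := by
  induction A generalizing r r' c c' <;> simp_all [rename, up_comp]

theorem rename_eq_subst {s : CpsSort} (A : Cps s) (r c : ℕ → ℕ) :
    rename r c A = subst (fun n => var (r n)) (fun n => cvar (c n)) A := by
  induction A generalizing r c with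
  | lam Q ih =>
    simp only [rename, subst, ih]
    congr 2 <;> funext n <;> cases n <;> rfl
  | kont Q ih =>
    simp only [rename, subst, ih]
    congr 2
    funext n; cases n <;> rfl
  | _ => simp_all [rename, subst]

theorem subst_rename {s : CpsSort} (A : Cps s) (σ : ℕ → Cps CpsSort.val)
    (κ : ℕ → Cps CpsSort.cont) (r c : ℕ → ℕ) :
    subst σ κ (rename r c A) = subst (fun n => σ (r n)) (fun n => κ (c n)) A := by
  induction A generalizing σ κ r c with
  | lam Q ih =>
    simp only [rename, subst, ih]
    congr 2 <;> funext n <;> cases n <;> rfl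
  | kont Q ih =>
    simp only [rename, subst, ih]
    congr 2
    funext n; cases n <;> rfl
  | _ => simp_all [rename, subst]

theorem rename_subst {s : CpsSort} (A : Cps s) (σ : ℕ → Cps CpsSort.val)
    (κ : ℕ → Cps CpsSort.cont) (r c : ℕ → ℕ) :
    rename r c (subst σ κ A) =
      subst (fun n => rename r c (σ n)) (fun n => rename r c (κ n)) A := by
  induction A generalizing σ κ r c with
  | lam Q ih =>
    simp only [rename, subst, ih]
    congr 2 <;> funext n <;> cases n <;> simp [rename, rename_rename] <;> rfl
  | kont Q ih =>
    simp only [rename, subst, ih]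
    congr 2 <;> funext n
    · cases n
      · rfl
      · simp [rename_rename]; rfl
    · simp [rename_rename]; rfl
  | _ => simp_all [rename, subst]

theorem subst_subst {s : CpsSort} (A : Cps s) (σ σ' : ℕ → Cps CpsSort.val)
    (κ κ' : ℕ → Cps CpsSort.cont) :
    subst σ' κ' (subst σ κ A) =
      subst (fun n => subst σ' κ' (σ n)) (fun n => subst σ' κ' (κ n)) A := by
  induction A generalizing σ κ σ' κ' with
  | lam Q ih =>
    simp only [subst, ih]
    congr 2 <;> funext n <;> cases n <;> simp [subst, subst_rename, rename_subst]
  | kont Q ih =>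
    simp only [subst, ih]
    congr 2 <;> funext n
    · cases n <;> simp [subst, subst_rename, rename_subst]
    · simp [subst_rename, rename_subst]
  | _ => simp_all [subst]

@[simp] theorem subst_id {s : CpsSort} (A : Cps s) : subst var cvar A = A := by
  induction A with
  | lam Q ih =>
    simp only [subst]
    congr 1
    conv_rhs => rw [← ih]
    congr 1 <;> funext n <;> cases n <;> rfl
  | kont Q ih =>
    simp only [subst]
    congr 1
    conv_rhs => rw [← ih]
    congr 1
    funext n; cases n <;> rfl
  | _ => simp_all [subst]

@[simp] theorem rename_id {s : CpsSort} (A : Cps s) : rename id id A = A := by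
  rw [rename_eq_subst]; exact subst_id A

theorem subst_eq_self {s : CpsSort} (A : Cps s) {σ : ℕ → Cps CpsSort.val}
    {κ : ℕ → Cps CpsSort.cont} (hσ : ∀ n, σ n = var n) (hκ : ∀ n, κ n = cvar n) :
    subst σ κ A = A := by
  rw [funext hσ, funext hκ]; exact subst_id A

/-! ### Reduction in the target calculus -/

/-- One-step reduction of the target calculus. -/
inductive Step : {s : CpsSort} → Cps s → Cps s → Prop
  | beta_ret (Q : Cps CpsSort.cmd) (W : Cps CpsSort.val) :
      Step (ret (kont Q) W) (subst (cons W var) cvar Q)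
  | beta_call (Q : Cps CpsSort.cmd) (W : Cps CpsSort.val) (K : Cps CpsSort.cont) :
      Step (call (lam Q) W K) (subst (cons W var) (cons K cvar) Q)
  | eta_cont (k : ℕ) : Step (kont (ret (cvar k) (var 0))) (cvar k)
  | eta_val (x : ℕ) : Step (lam (call (var (x + 1)) (var 0) (cvar 0))) (var x)
  | lam {Q Q' : Cps CpsSort.cmd} : Step Q Q' → Step (lam Q) (lam Q')
  | kont {Q Q' : Cps CpsSort.cmd} : Step Q Q' → Step (kont Q) (kont Q')
  | ret_left {K K' : Cps CpsSort.cont} (W : Cps CpsSort.val) :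
      Step K K' → Step (ret K W) (ret K' W)
  | ret_right (K : Cps CpsSort.cont) {W W' : Cps CpsSort.val} :
      Step W W' → Step (ret K W) (ret K W')
  | call_fun {V V' : Cps CpsSort.val} (W : Cps CpsSort.val) (K : Cps CpsSort.cont) :
      Step V V' → Step (call V W K) (call V' W K)
  | call_arg (V : Cps CpsSort.val) {W W' : Cps CpsSort.val} (K : Cps CpsSort.cont) :
      Step W W' → Step (call V W K) (call V W' K)
  | call_cont (V W : Cps CpsSort.val) {K K' : Cps CpsSort.cont} :
      Step K K' → Step (call V W K) (call V W K')

/-- Many-step reduction of the target calculus. -/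
abbrev Steps {s : CpsSort} : Cps s → Cps s → Prop := Relation.ReflTransGen Step

theorem Steps.lam {Q Q' : Cps CpsSort.cmd} (h : Steps Q Q') : Steps (lam Q) (lam Q') :=
  Relation.ReflTransGen.lift Cps.lam (fun _ _ => Step.lam) _ _ h

theorem Steps.kont {Q Q' : Cps CpsSort.cmd} (h : Steps Q Q') : Steps (kont Q) (kont Q') :=
  Relation.ReflTransGen.lift Cps.kont (fun _ _ => Step.kont) _ _ h

theorem Steps.ret {K K' : Cps CpsSort.cont} {W W' : Cps CpsSort.val} (hK : Steps K K')
    (hW : Steps W W') : Steps (ret K W) (ret K' W') :=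
  .trans (Relation.ReflTransGen.lift (fun K => Cps.ret K W) (fun _ _ => Step.ret_left W) _ _ hK)
    (Relation.ReflTransGen.lift (fun W => Cps.ret K' W) (fun _ _ => Step.ret_right K') _ _ hW)

theorem Steps.call {V V' W W' : Cps CpsSort.val} {K K' : Cps CpsSort.cont} (hV : Steps V V')
    (hW : Steps W W') (hK : Steps K K') : Steps (call V W K) (call V' W' K') :=
  .trans (Relation.ReflTransGen.lift (fun V => Cps.call V W K) (fun _ _ => Step.call_fun W K)
      _ _ hV) (.trans (Relation.ReflTransGen.lift (fun W => Cps.call V' W K) (fun _ _ => Step.call_arg V' K)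
      _ _ hW) (Relation.ReflTransGen.lift (fun K => Cps.call V' W' K)
      (fun _ _ => Step.call_cont V' W') _ _ hK))

theorem steps_of_eq {s : CpsSort} {A B : Cps s} (h : A = B) : Steps A B := h ▸ .refl

/-- The rule only contracts η-redexes of variables. For an abstraction the η-redex contains a
β-redex, whose contraction has the same effect. -/
theorem steps_eta_cont (K : Cps CpsSort.cont) :
    Steps (kont (ret (rename Nat.succ id K) (var 0))) K := by
  cases K with
  | cvar k => exact .single (Step.eta_cont k)
  | kont Q =>
    refine .single (Step.kont ?_)
    have h := Step.beta_ret (rename (up Nat.succ) id Q) (var 0)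
    rw [subst_rename, subst_eq_self _ (by rintro (_ | n) <;> rfl) (by intro; rfl)] at h
    exact h

theorem steps_eta_val (W : Cps CpsSort.val) :
    Steps (lam (call (rename Nat.succ Nat.succ W) (var 0) (cvar 0))) W := by
  cases W with
  | var x => exact .single (Step.eta_val x)
  | lam Q =>
    refine .single (Step.lam ?_)
    have h := Step.beta_call (rename (up Nat.succ) (up Nat.succ) Q) (var 0) (cvar 0)
    rw [subst_rename, subst_eq_self _ (by rintro (_ | n) <;> rfl)
      (by rintro (_ | n) <;> rfl)] at h
    exact h

/-- A single step may not stay single: substituting into a variable η-redex yields a general one,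
which is handled by `steps_eta_cont` and `steps_eta_val`. -/
theorem Step.subst {s : CpsSort} {A B : Cps s} (h : Step A B) (σ : ℕ → Cps CpsSort.val)
    (κ : ℕ → Cps CpsSort.cont) : Steps (subst σ κ A) (subst σ κ B) := by
  induction h generalizing σ κ with
  | beta_ret Q W =>
    refine (Relation.ReflTransGen.single (Step.beta_ret _ _)).trans (steps_of_eq ?_)
    simp only [subst_subst]
    congr 1 <;> funext n
    · cases n <;> simp [Cps.subst, subst_rename]
    · simp [Cps.subst, subst_rename]
  | beta_call Q W K =>
    refine (Relation.ReflTransGen.single (Step.beta_call _ _ _)).trans (steps_of_eq ?_)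
    simp only [subst_subst]
    congr 1 <;> funext n <;> cases n <;> simp [Cps.subst, subst_rename]
  | eta_cont k => exact steps_eta_cont (κ k)
  | eta_val x => exact steps_eta_val (σ x)
  | lam _ ih => exact (ih _ _).lam
  | kont _ ih => exact (ih _ _).kont
  | ret_left _ _ ih => exact (ih _ _).ret .refl
  | ret_right _ _ ih => exact Steps.ret .refl (ih _ _)
  | call_fun _ _ _ ih => exact (ih _ _).call .refl .refl
  | call_arg _ _ _ ih => exact Steps.call .refl (ih _ _) .refl
  | call_cont _ _ _ ih => exact Steps.call .refl .refl (ih _ _)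

theorem Steps.subst {s : CpsSort} {A B : Cps s} (h : Steps A B) (σ : ℕ → Cps CpsSort.val)
    (κ : ℕ → Cps CpsSort.cont) : Steps (subst σ κ A) (subst σ κ B) := by
  induction h with
  | refl => exact .refl
  | tail _ h ih => exact ih.trans (h.subst σ κ)

theorem Steps.rename {s : CpsSort} {A B : Cps s} (h : Steps A B) (r c : ℕ → ℕ) :
    Steps (rename r c A) (rename r c B) := by
  simpa only [rename_eq_subst] using h.subst _ _

theorem steps_subst_right {s : CpsSort} (A : Cps s) {σ σ' : ℕ → Cps CpsSort.val}
    {κ κ' : ℕ → Cps CpsSort.cont} (hσ : ∀ n, Steps (σ n) (σ' n)) (hκ : ∀ n, Steps (κ n) (κ' n)) :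
    Steps (subst σ κ A) (subst σ' κ' A) := by
  induction A generalizing σ σ' κ κ' with
  | var x => exact hσ x
  | cvar k => exact hκ k
  | lam Q ih =>
    refine (ih ?_ ?_).lam <;> rintro (_ | n)
    · exact .refl
    · exact (hσ n).rename _ _
    · exact .refl
    · exact (hκ n).rename _ _
  | kont Q ih =>
    refine (ih ?_ fun n => (hκ n).rename _ _).kont
    rintro (_ | n)
    · exact .refl
    · exact (hσ n).rename _ _
  | ret K W ihK ihW => exact (ihK hσ hκ).ret (ihW hσ hκ)
  | call V W K ihV ihW ihK => exact (ihV hσ hκ).call (ihW hσ hκ) (ihK hσ hκ)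

/-- Renaming creates no redex, even if it is not injective: under a binder, index `0` is fixed and
no successor is sent to `0`, so η-patterns are reflected too. -/
theorem Step.of_rename {s : CpsSort} (A : Cps s) {r c : ℕ → ℕ} {B : Cps s}
    (h : Step (rename r c A) B) : ∃ B', B = rename r c B' ∧ Step A B' := by
  induction A generalizing r c with
  | var x => cases h
  | cvar k => cases h
  | lam Q ih =>
    rw [Cps.rename] at h
    generalize hQ : Cps.rename (up r) (up c) Q = Q₁ at h
    cases h with
    | lam h =>
      subst hQ
      obtain ⟨Q', rfl, h'⟩ := ih h
      exact ⟨_, rfl, h'.lam⟩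
    | eta_val x =>
      rcases Q with _ | _ | _ | _ | _ | ⟨_ | _, _ | _, _ | _⟩ <;> simp [Cps.rename] at hQ
      rename_i a b d
      rcases a with _ | a <;> rcases b with _ | b <;> rcases d with _ | d <;> simp at hQ
      exact ⟨var a, by simp [Cps.rename, hQ], Step.eta_val a⟩
  | kont Q ih =>
    rw [Cps.rename] at h
    generalize hQ : Cps.rename (up r) c Q = Q₁ at h
    cases h with
    | kont h =>
      subst hQ
      obtain ⟨Q', rfl, h'⟩ := ih h
      exact ⟨_, rfl, h'.kont⟩
    | eta_cont x =>
      rcases Q with _ | _ | _ | _ | ⟨_ | _, _ | _⟩ | _ <;> simp [Cps.rename] at hQ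
      rename_i a b
      rcases b with _ | b <;> simp at hQ
      exact ⟨cvar a, by simp [Cps.rename, hQ], Step.eta_cont a⟩
  | ret K W ihK ihW =>
    rw [Cps.rename] at h
    generalize hK : Cps.rename r c K = K₁ at h
    cases h with
    | ret_left _ h =>
      subst hK
      obtain ⟨K', rfl, h'⟩ := ihK h
      exact ⟨_, rfl, h'.ret_left W⟩
    | ret_right _ h =>
      subst hK
      obtain ⟨W', rfl, h'⟩ := ihW h
      exact ⟨_, rfl, h'.ret_right K⟩
    | beta_ret Q _ =>
      rcases K with _ | _ | _ | Q' <;> simp [Cps.rename] at hK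
      subst hK
      refine ⟨_, ?_, Step.beta_ret Q' W⟩
      rw [rename_subst, subst_rename]
      congr 1
      funext n; cases n <;> rfl
  | call V W K ihV ihW ihK =>
    rw [Cps.rename] at h
    generalize hV : Cps.rename r c V = V₁ at h
    cases h with
    | call_fun _ _ h =>
      subst hV
      obtain ⟨V', rfl, h'⟩ := ihV h
      exact ⟨_, rfl, h'.call_fun W K⟩
    | call_arg _ _ h =>
      subst hV
      obtain ⟨W', rfl, h'⟩ := ihW h
      exact ⟨_, rfl, h'.call_arg V K⟩
    | call_cont _ _ h =>
      subst hV
      obtain ⟨K', rfl, h'⟩ := ihK h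
      exact ⟨_, rfl, h'.call_cont V W⟩
    | beta_call Q _ _ =>
      rcases V with _ | Q' <;> simp [Cps.rename] at hV
      subst hV
      refine ⟨_, ?_, Step.beta_call Q' W K⟩
      rw [rename_subst, subst_rename]
      congr 1 <;> funext n <;> cases n <;> rfl

/-! ### Complete developments and confluence of the target -/

theorem rename_cancel {s : CpsSort} {r c r' c' : ℕ → ℕ} (hr : r ∘ r' = id) (hc : c ∘ c' = id)
    (A : Cps s) : rename r c (rename r' c' A) = A := by
  rw [rename_rename, hr, hc, rename_id]

open Classical in
/-- Contract the continuation `λx. Q` if it is an `η`-redex. -/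
noncomputable def etaCont (Q : Cps CpsSort.cmd) : Cps CpsSort.cont :=
  if h : ∃ K, Q = ret (rename Nat.succ id K) (var 0) then h.choose else kont Q

open Classical in
/-- Contract the value `λ(x, k). Q` if it is an `η`-redex. -/
noncomputable def etaVal (Q : Cps CpsSort.cmd) : Cps CpsSort.val :=
  if h : ∃ W, Q = call (rename Nat.succ Nat.succ W) (var 0) (cvar 0) then h.choose else lam Q

@[simp] theorem etaCont_ret (K : Cps CpsSort.cont) :
    etaCont (ret (rename Nat.succ id K) (var 0)) = K := by
  have h : ∃ K', ret (rename Nat.succ id K) (var 0) = ret (rename Nat.succ id K') (var 0) :=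
    ⟨K, rfl⟩
  rw [etaCont, dif_pos h]
  -- Weakening is injective because lowering the indices is a left inverse; so the chosen
  -- continuation is `K`.
  have h' := congrArg (rename Nat.pred id) (Cps.ret.inj h.choose_spec).1
  rw [rename_cancel rfl rfl, rename_cancel rfl rfl] at h'
  exact h'.symm

@[simp] theorem etaVal_call (W : Cps CpsSort.val) :
    etaVal (call (rename Nat.succ Nat.succ W) (var 0) (cvar 0)) = W := by
  have h : ∃ W', call (rename Nat.succ Nat.succ W) (var 0) (cvar 0) =
    call (rename Nat.succ Nat.succ W') (var 0) (cvar 0) := ⟨W, rfl⟩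
  rw [etaVal, dif_pos h]
  have h' := congrArg (rename Nat.pred Nat.pred) (Cps.call.inj h.choose_spec).1
  rw [rename_cancel rfl rfl, rename_cancel rfl rfl] at h'
  exact h'.symm

theorem etaCont_cases (Q : Cps CpsSort.cmd) :
    (∃ K, Q = ret (rename Nat.succ id K) (var 0)) ∨ etaCont Q = kont Q := by
  by_cases h : ∃ K, Q = ret (rename Nat.succ id K) (var 0)
  · exact .inl h
  · exact .inr (dif_neg h)

theorem etaVal_cases (Q : Cps CpsSort.cmd) :
    (∃ W, Q = call (rename Nat.succ Nat.succ W) (var 0) (cvar 0)) ∨ etaVal Q = lam Q := by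
  by_cases h : ∃ W, Q = call (rename Nat.succ Nat.succ W) (var 0) (cvar 0)
  · exact .inl h
  · exact .inr (dif_neg h)

theorem steps_etaCont (Q : Cps CpsSort.cmd) : Steps (kont Q) (etaCont Q) := by
  rcases etaCont_cases Q with ⟨K, rfl⟩ | h
  · simpa using steps_eta_cont K
  · rw [h]

theorem steps_etaVal (Q : Cps CpsSort.cmd) : Steps (lam Q) (etaVal Q) := by
  rcases etaVal_cases Q with ⟨K, rfl⟩ | h
  · simpa using steps_eta_val K
  · rw [h]

/-- Either all steps take place inside `K`, and the final η-contraction removes the wrapper, or at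
some moment `K` has become an abstraction and the outer β-redex fires. Firing leaves the body of
`K`, so the remaining steps can be performed under the abstraction. -/
theorem steps_etaCont_of_steps_ret {K : Cps CpsSort.cont} {X : Cps CpsSort.cmd}
    (h : Steps (ret (rename Nat.succ id K) (var 0)) X) : Steps K (etaCont X) := by
  generalize hY : ret (rename Nat.succ id K) (var 0) = Y at h
  induction h using Relation.ReflTransGen.head_induction_on generalizing K with
  | refl => rw [← hY, etaCont_ret]
  | head h h' ih =>
    subst hY
    generalize hK : rename Nat.succ id K = K₁ at h
    cases h with
    | ret_left _ h =>
      subst hK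
      obtain ⟨K', rfl, h''⟩ := Step.of_rename _ h
      exact .head h'' (ih rfl)
    | ret_right _ h => cases h
    | beta_ret Q _ =>
      rcases K with _ | _ | _ | R <;> simp [rename] at hK
      subst hK
      rw [subst_rename, subst_eq_self _ (by rintro (_ | n) <;> rfl) (by intro; rfl)] at h'
      exact .trans (Steps.kont h') (steps_etaCont X)

theorem steps_etaVal_of_steps_call {W : Cps CpsSort.val} {X : Cps CpsSort.cmd}
    (h : Steps (call (rename Nat.succ Nat.succ W) (var 0) (cvar 0)) X) : Steps W (etaVal X) := by
  generalize hY : call (rename Nat.succ Nat.succ W) (var 0) (cvar 0) = Y at h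
  induction h using Relation.ReflTransGen.head_induction_on generalizing W with
  | refl => rw [← hY, etaVal_call]
  | head h h' ih =>
    subst hY
    generalize hW : rename Nat.succ Nat.succ W = W₁ at h
    cases h with
    | call_fun _ _ h =>
      subst hW
      obtain ⟨W', rfl, h''⟩ := Step.of_rename _ h
      exact .head h'' (ih rfl)
    | call_arg _ _ h => cases h
    | call_cont _ _ h => cases h
    | beta_call Q _ _ =>
      rcases W with _ | R <;> simp [rename] at hW
      subst hW
      rw [subst_rename, subst_eq_self _ (by rintro (_ | n) <;> rfl)
        (by rintro (_ | n) <;> rfl)] at h'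
      exact .trans (Steps.lam h') (steps_etaVal X)

theorem Steps.etaCont {Q Q' : Cps CpsSort.cmd} (h : Steps Q Q') :
    Steps (etaCont Q) (etaCont Q') := by
  rcases etaCont_cases Q with ⟨K, rfl⟩ | hQ
  · rw [etaCont_ret]; exact steps_etaCont_of_steps_ret h
  · rw [hQ]; exact h.kont.trans (steps_etaCont Q')

theorem Steps.etaVal {Q Q' : Cps CpsSort.cmd} (h : Steps Q Q') :
    Steps (etaVal Q) (etaVal Q') := by
  rcases etaVal_cases Q with ⟨K, rfl⟩ | hQ
  · rw [etaVal_call]; exact steps_etaVal_of_steps_call h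
  · rw [hQ]; exact h.lam.trans (steps_etaVal Q')

/-- The complete development. -/
noncomputable def dev : {s : CpsSort} → Cps s → Cps s
  | _, var x => var x
  | _, lam Q => etaVal (dev Q)
  | _, cvar k => cvar k
  | _, kont Q => etaCont (dev Q)
  | _, ret (kont Q) W => subst (cons (dev W) var) cvar (dev Q)
  | _, ret (cvar k) W => ret (cvar k) (dev W)
  | _, call (lam Q) W K => subst (cons (dev W) var) (cons (dev K) cvar) (dev Q)
  | _, call (var x) W K => call (var x) (dev W) (dev K)

/-- A β-redex overlaps with an η-redex when the developed body of `K` is one. Then the η-contraction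
in `dev K` and the β-contraction in `dev (ret K W)` give the same command. -/
theorem steps_dev_ret (K : Cps CpsSort.cont) (W : Cps CpsSort.val) :
    Steps (ret (dev K) (dev W)) (dev (ret K W)) := by
  cases K with
  | cvar k => simp only [dev]; exact .refl
  | kont Q =>
    simp only [dev]
    rcases etaCont_cases (dev Q) with ⟨K, h⟩ | h
    · rw [h, etaCont_ret]
      exact steps_of_eq (by simp [subst, subst_rename])
    · rw [h]; exact .single (Step.beta_ret _ _)

theorem steps_dev_call (V W : Cps CpsSort.val) (K : Cps CpsSort.cont) :
    Steps (call (dev V) (dev W) (dev K)) (dev (call V W K)) := by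
  cases V with
  | var x => simp only [dev]; exact .refl
  | lam Q =>
    simp only [dev]
    rcases etaVal_cases (dev Q) with ⟨V, h⟩ | h
    · rw [h, etaVal_call]
      exact steps_of_eq (by simp [subst, subst_rename])
    · rw [h]; exact .single (Step.beta_call _ _ _)

theorem steps_dev {s : CpsSort} (A : Cps s) : Steps A (dev A) := by
  induction A with
  | var x => simp only [dev]; exact .refl
  | cvar k => simp only [dev]; exact .refl
  | lam Q ih => simp only [dev]; exact ih.lam.trans (steps_etaVal _)
  | kont Q ih => simp only [dev]; exact ih.kont.trans (steps_etaCont _)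
  | ret K W ihK ihW => exact (ihK.ret ihW).trans (steps_dev_ret K W)
  | call V W K ihV ihW ihK => exact (ihV.call ihW ihK).trans (steps_dev_call V W K)

theorem steps_rename_dev {s : CpsSort} (A : Cps s) (r c : ℕ → ℕ) :
    Steps (rename r c (dev A)) (dev (rename r c A)) := by
  induction A using dev.induct generalizing r c with
  | case1 x => simp only [dev, rename]; exact .refl
  | case2 Q ih =>
    simp only [dev, rename]
    have h := (ih (up r) (up c)).etaVal
    rcases etaVal_cases (dev Q) with ⟨W, hW⟩ | hW
    · rw [hW, etaVal_call]
      refine .trans (steps_of_eq ?_) h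
      rw [hW]
      rw [← etaVal_call (rename r c W)]
      simp only [rename, rename_rename]
      rfl
    · rw [hW]
      exact (ih _ _).lam.trans (steps_etaVal _)
  | case3 k => simp only [dev, rename]; exact .refl
  | case4 Q ih =>
    simp only [dev, rename]
    have h := (ih (up r) c).etaCont
    rcases etaCont_cases (dev Q) with ⟨W, hW⟩ | hW
    · rw [hW, etaCont_ret]
      refine .trans (steps_of_eq ?_) h
      rw [hW]
      rw [← etaCont_ret (rename r c W)]
      simp only [rename, rename_rename]
      rfl
    · rw [hW]
      exact (ih _ _).kont.trans (steps_etaCont _)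
  | case5 Q W ihW ihQ =>
    simp only [dev, rename]
    refine .trans (.trans (steps_of_eq ?_) ((ihQ (up r) c).subst
      (cons (rename r c (dev W)) var) cvar))
      (steps_subst_right _ ?_ fun _ => .refl)
    · rw [rename_subst, subst_rename]
      congr 1
      funext n; cases n <;> rfl
    · rintro (_ | n)
      exacts [ihW _ _, .refl]
  | case6 k W ih => simp only [dev, rename]; exact Steps.ret .refl (ih _ _)
  | case7 Q W K ihW ihK ihQ =>
    simp only [dev, rename]
    refine .trans (.trans (steps_of_eq ?_) ((ihQ (up r) (up c)).subst (cons (rename r c (dev W)) var)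
      (cons (rename r c (dev K)) cvar))) (steps_subst_right _ ?_ ?_)
    · rw [rename_subst, subst_rename]
      congr 1 <;> funext n <;> cases n <;> rfl
    · rintro (_ | n)
      exacts [ihW _ _, .refl]
    · rintro (_ | n)
      exacts [ihK _ _, .refl]
  | case8 x W K ihW ihK => simp only [dev, rename]; exact Steps.call .refl (ihW _ _) (ihK _ _)

/-- Reduction, and not equality, is the right relation: substitution can create redexes, and these
are contracted on the right only. -/
theorem steps_subst_dev {s : CpsSort} (A : Cps s) (σ : ℕ → Cps CpsSort.val)
    (κ : ℕ → Cps CpsSort.cont) :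
    Steps (subst (fun n => dev (σ n)) (fun n => dev (κ n)) (dev A)) (dev (subst σ κ A)) := by
  induction A using dev.induct generalizing σ κ with
  | case1 x => simp only [dev, subst]; exact .refl
  | case2 Q ih =>
    have h : Steps _ _ := .trans (steps_subst_right (dev Q) (σ := cons (var 0) fun n =>
      rename Nat.succ Nat.succ (dev (σ n))) (κ := cons (cvar 0) fun n =>
      rename Nat.succ Nat.succ (dev (κ n))) ?_ ?_) (ih (cons (var 0) fun n =>
        rename Nat.succ Nat.succ (σ n)) (cons (cvar 0) fun n => rename Nat.succ Nat.succ (κ n)))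
    · simp only [dev, subst]
      rcases etaVal_cases (dev Q) with ⟨W, hW⟩ | hW
      · rw [hW, etaVal_call]
        apply steps_etaVal_of_steps_call
        rw [hW] at h
        simpa [subst, subst_rename, rename_subst] using h
      · rw [hW]
        exact h.lam.trans (steps_etaVal _)
    · rintro (_ | n)
      · simp only [dev, cons]; exact .refl
      · exact steps_rename_dev _ _ _
    · rintro (_ | n)
      · simp only [dev, cons]; exact .refl
      · exact steps_rename_dev _ _ _
  | case3 k => simp only [dev, subst]; exact .refl
  | case4 Q ih =>
    have h : Steps _ _ := .trans (steps_subst_right (dev Q) (σ := cons (var 0) fun n =>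
      rename Nat.succ id (dev (σ n))) (κ := fun n =>
      rename Nat.succ id (dev (κ n))) ?_ ?_) (ih (cons (var 0) fun n =>
        rename Nat.succ id (σ n)) (fun n => rename Nat.succ id (κ n)))
    · simp only [dev, subst]
      rcases etaCont_cases (dev Q) with ⟨W, hW⟩ | hW
      · rw [hW, etaCont_ret]
        apply steps_etaCont_of_steps_ret
        rw [hW] at h
        simpa [subst, subst_rename, rename_subst] using h
      · rw [hW]
        exact h.kont.trans (steps_etaCont _)
    · rintro (_ | n)
      · simp only [dev, cons]; exact .refl
      · exact steps_rename_dev _ _ _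
    · exact fun n => steps_rename_dev _ _ _
  | case5 Q W ihW ihQ =>
    simp only [dev, subst]
    refine .trans (steps_of_eq ?_) (.trans ((steps_subst_right (dev Q) (σ := cons (var 0) fun n =>
      rename Nat.succ id (dev (σ n))) (κ := fun n =>
      rename Nat.succ id (dev (κ n))) ?_ ?_).subst (cons (subst (fun n => dev (σ n))
        (fun n => dev (κ n)) (dev W)) var) cvar)
      (((ihQ (cons (var 0) fun n => rename Nat.succ id (σ n))
        (fun n => rename Nat.succ id (κ n))).subst _ _).trans
      (steps_subst_right _ ?_ fun _ => .refl)))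
    · simp only [subst_subst]
      congr 1 <;> funext n
      · cases n <;> simp [subst, subst_rename]
      · simp [subst, subst_rename]
    · rintro (_ | n)
      · simp only [dev, cons]; exact .refl
      · exact steps_rename_dev _ _ _
    · exact fun n => steps_rename_dev _ _ _
    · rintro (_ | n)
      exacts [ihW _ _, .refl]
  | case6 k W ih =>
    simp only [dev, subst]
    exact (Steps.ret .refl (ih _ _)).trans (steps_dev_ret _ _)
  | case7 Q W K ihW ihK ihQ =>
    simp only [dev, subst]
    refine .trans (steps_of_eq ?_) (.trans ((steps_subst_right (dev Q) (σ := cons (var 0) fun n =>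
      rename Nat.succ Nat.succ (dev (σ n))) (κ := cons (cvar 0) fun n =>
      rename Nat.succ Nat.succ (dev (κ n))) ?_ ?_).subst (cons (subst (fun n => dev (σ n))
        (fun n => dev (κ n)) (dev W)) var) (cons (subst (fun n => dev (σ n))
        (fun n => dev (κ n)) (dev K)) cvar))
      (((ihQ (cons (var 0) fun n => rename Nat.succ Nat.succ (σ n))
        (cons (cvar 0) fun n => rename Nat.succ Nat.succ (κ n))).subst _ _).trans
      (steps_subst_right _ ?_ ?_)))
    · simp only [subst_subst]
      congr 1 <;> funext n <;> cases n <;> simp [subst, subst_rename]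
    · rintro (_ | n)
      · simp only [dev, cons]; exact .refl
      · exact steps_rename_dev _ _ _
    · rintro (_ | n)
      · simp only [dev, cons]; exact .refl
      · exact steps_rename_dev _ _ _
    · rintro (_ | n)
      exacts [ihW _ _, .refl]
    · rintro (_ | n)
      exacts [ihK _ _, .refl]
  | case8 x W K ihW ihK =>
    simp only [dev, subst]
    exact (Steps.call .refl (ihW _ _) (ihK _ _)).trans (steps_dev_call _ _ _)

/-- First half of the Z-property: the development contracts at least the redex of the given step. -/
theorem Step.steps_dev {s : CpsSort} {A B : Cps s} (h : Step A B) : Steps B (dev A) := by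
  induction h with
  | beta_ret Q W =>
    simp only [dev]
    refine ((Cps.steps_dev Q).subst _ _).trans (steps_subst_right _ ?_ fun _ => .refl)
    rintro (_ | n)
    exacts [Cps.steps_dev W, .refl]
  | beta_call Q W K =>
    simp only [dev]
    refine ((Cps.steps_dev Q).subst _ _).trans (steps_subst_right _ ?_ ?_) <;> rintro (_ | n)
    exacts [Cps.steps_dev W, .refl, Cps.steps_dev K, .refl]
  | eta_cont k =>
    simp only [dev]
    exact steps_of_eq (etaCont_ret (cvar k)).symm
  | eta_val x =>
    simp only [dev]
    exact steps_of_eq (etaVal_call (var x)).symm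
  | lam _ ih => simp only [dev]; exact ih.lam.trans (steps_etaVal _)
  | kont _ ih => simp only [dev]; exact ih.kont.trans (steps_etaCont _)
  | ret_left W _ ih => exact (ih.ret (Cps.steps_dev W)).trans (steps_dev_ret _ _)
  | ret_right K _ ih => exact (Steps.ret (Cps.steps_dev K) ih).trans (steps_dev_ret _ _)
  | call_fun W K _ ih =>
    exact (ih.call (Cps.steps_dev W) (Cps.steps_dev K)).trans (steps_dev_call _ _ _)
  | call_arg V K _ ih =>
    exact (Steps.call (Cps.steps_dev V) ih (Cps.steps_dev K)).trans (steps_dev_call _ _ _)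
  | call_cont V W _ ih =>
    exact (Steps.call (Cps.steps_dev V) (Cps.steps_dev W) ih).trans (steps_dev_call _ _ _)

/-- Second half of the Z-property. At a root β-step `steps_subst_dev` applies; where β and η overlap
the two developments coincide. -/
theorem Step.dev {s : CpsSort} (A : Cps s) {B : Cps s} (h : Step A B) :
    Steps (dev A) (dev B) := by
  induction A using dev.induct with
  | case1 x => cases h
  | case2 Q ih =>
    cases h with
    | lam h => simp only [Cps.dev]; exact (ih h).etaVal
    | eta_val x => simp only [Cps.dev]; exact steps_of_eq (etaVal_call (var x))
  | case3 k => cases h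
  | case4 Q ih =>
    cases h with
    | kont h => simp only [Cps.dev]; exact (ih h).etaCont
    | eta_cont k => simp only [Cps.dev]; exact steps_of_eq (etaCont_ret (cvar k))
  | case5 Q W ihW ihQ =>
    cases h with
    | beta_ret =>
      simp only [Cps.dev]
      refine .trans (steps_of_eq ?_) (steps_subst_dev Q (cons W var) cvar)
      congr 1
      funext n
      cases n <;> simp [Cps.dev]
    | ret_left _ h =>
      cases h with
      | kont h => simp only [Cps.dev]; exact (ihQ h).subst _ _
      | eta_cont k => exact steps_of_eq (by simp [Cps.dev, Cps.subst])
    | ret_right _ h =>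
      simp only [Cps.dev]
      refine steps_subst_right _ ?_ fun _ => .refl
      rintro (_ | n)
      exacts [ihW h, .refl]
  | case6 k W ih =>
    cases h with
    | ret_left _ h => cases h
    | ret_right _ h => simp only [Cps.dev]; exact Steps.ret .refl (ih h)
  | case7 Q W K ihW ihK ihQ =>
    cases h with
    | beta_call =>
      simp only [Cps.dev]
      refine .trans (steps_of_eq ?_) (steps_subst_dev Q (cons W var) (cons K cvar))
      congr 1 <;> funext n <;> cases n <;> simp [Cps.dev]
    | call_fun _ _ h =>
      cases h with
      | lam h => simp only [Cps.dev]; exact (ihQ h).subst _ _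
      | eta_val x => exact steps_of_eq (by simp [Cps.dev, Cps.subst])
    | call_arg _ _ h =>
      simp only [Cps.dev]
      refine steps_subst_right _ ?_ fun _ => .refl
      rintro (_ | n)
      exacts [ihW h, .refl]
    | call_cont _ _ h =>
      simp only [Cps.dev]
      refine steps_subst_right _ (fun _ => .refl) ?_
      rintro (_ | n)
      exacts [ihK h, .refl]
  | case8 x W K ihW ihK =>
    cases h with
    | call_fun _ _ h => cases h
    | call_arg _ _ h => simp only [Cps.dev]; exact Steps.call .refl (ihW h) .refl
    | call_cont _ _ h => simp only [Cps.dev]; exact Steps.call .refl .refl (ihK h)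

theorem Steps.dev {s : CpsSort} {A B : Cps s} (h : Steps A B) : Steps (dev A) (dev B) := by
  induction h with
  | refl => exact .refl
  | tail _ h ih => exact ih.trans (Step.dev _ h)

/-- The target calculus is confluent. -/
theorem confluent {s : CpsSort} {A B C : Cps s} (hB : Steps A B) (hC : Steps A C) :
    Relation.Join Steps B C := by
  induction hB using Relation.ReflTransGen.head_induction_on generalizing C with
  | refl => exact ⟨C, hC, .refl⟩
  | head h _ ih =>
    -- The first step leads to a term which reduces to `dev A` and, by monotonicity, on to `dev C`.
    -- The induction hypothesis joins this with `B`, and `C` itself reduces to `dev C`.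
    obtain ⟨E, hE, hE'⟩ := ih (h.steps_dev.trans hC.dev)
    exact ⟨E, hE, (steps_dev C).trans hE'⟩

/-- Convertibility in the target calculus. -/
abbrev Conv {s : CpsSort} : Cps s → Cps s → Prop := Relation.Join Steps

theorem conv_equivalence {s : CpsSort} : Equivalence (Conv (s := s)) :=
  Relation.equivalence_join fun _ _ _ => confluent

end Cps


/-! ### The CPS translation -/

open Cps (Steps Step Conv)

/-- The number of return continuations of the translation of an expression is one for a term and
zero for a jump. The continuation variables of the expression are shifted accordingly. -/
def Cat.shift : Cat → ℕ → ℕ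
  | Cat.term => Nat.succ
  | Cat.jump => id

/-- Extend a substitution for continuation variables to the return continuation, if any. -/
def Cat.liftEnv : Cat → (ℕ → Cps CpsSort.cont) → ℕ → Cps CpsSort.cont
  | Cat.term, κ => cons (Cps.cvar 0) fun n => Cps.rename id Nat.succ (κ n)
  | Cat.jump, κ => κ

namespace Expr

/-- Whether an expression is a value. -/
def isVal : {s : Cat} → Expr s → Bool
  | _, var _ => true
  | _, lam _ => true
  | _, _ => false

@[simp] theorem isVal_var (x : ℕ) : isVal (var x) = true := rfl

theorem isVal_iff {M : Expr Cat.term} : isVal M = true ↔ IsValue M := by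
  constructor
  · intro h
    cases M <;> first | exact IsValue.var _ | exact IsValue.lam _ | cases h
  · rintro (_ | _) <;> rfl

end Expr

namespace Cps

/-- Plug the continuation `K` into the return continuation of `Q`, where the remaining
continuation variables of `Q` are those of an expression of category `s`. -/
def plug (s : Cat) (Q : Cps CpsSort.cmd) (K : Cps CpsSort.cont) : Cps CpsSort.cmd :=
  subst var (cons K fun n => cvar (s.shift n)) Q

/-- The translation of the application of a value to a term, which is a value if `b` holds. -/
def appArg (V : Cps CpsSort.val) (b : Bool) (Q : Cps CpsSort.cmd) (W : Cps CpsSort.val) :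
    Cps CpsSort.cmd :=
  if b then call (rename id Nat.succ V) (rename id Nat.succ W) (cvar 0)
  else plug Cat.term Q (kont (call (rename Nat.succ Nat.succ V) (var 0) (cvar 0)))

/-- The translation of the application of two terms. -/
def appCps (a : Bool) (P : Cps CpsSort.cmd) (V : Cps CpsSort.val) (b : Bool)
    (Q : Cps CpsSort.cmd) (W : Cps CpsSort.val) : Cps CpsSort.cmd :=
  if a then appArg V b Q W
  else plug Cat.term P (kont (appArg (var 0) b (rename Nat.succ id Q) (rename Nat.succ id W)))

theorem subst_congr {s : CpsSort} (A : Cps s) {σ σ' : ℕ → Cps CpsSort.val}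
    {κ κ' : ℕ → Cps CpsSort.cont} (hσ : ∀ n, σ n = σ' n) (hκ : ∀ n, κ n = κ' n) :
    subst σ κ A = subst σ' κ' A := by
  rw [funext hσ, funext hκ]

theorem plug_subst (s : Cat) (Q : Cps CpsSort.cmd) (K : Cps CpsSort.cont)
    (σ : ℕ → Cps CpsSort.val) (κ : ℕ → Cps CpsSort.cont) :
    subst (fun n => rename id s.shift (σ n)) (s.liftEnv κ) (plug s Q K) =
      plug s (subst (fun n => rename id Nat.succ (σ n)) (Cat.term.liftEnv κ) Q)
        (subst (fun n => rename id s.shift (σ n)) (s.liftEnv κ) K) := by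
  simp only [plug, subst_subst]
  congr 1 <;> funext n
  · simp only [subst, subst_rename]
    rw [rename_eq_subst]
    rfl
  · cases n with
    | zero => rfl
    | succ n =>
      simp only [subst, subst_rename, cons_succ, Cat.liftEnv]
      cases s
      · simp only [Cat.shift, cons_succ, rename_eq_subst]
      · exact (subst_id _).symm

theorem appArg_subst (V : Cps CpsSort.val) (b : Bool) (Q : Cps CpsSort.cmd)
    (W : Cps CpsSort.val) (σ : ℕ → Cps CpsSort.val) (κ : ℕ → Cps CpsSort.cont) :
    subst (fun n => rename id Nat.succ (σ n)) (Cat.term.liftEnv κ) (appArg V b Q W) =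
      appArg (subst σ κ V) b
        (subst (fun n => rename id Nat.succ (σ n)) (Cat.term.liftEnv κ) Q) (subst σ κ W) := by
  cases b
  · simp only [appArg]
    refine (plug_subst Cat.term _ _ σ κ).trans ?_
    simp [subst, subst_rename, rename_subst, rename_rename, Cat.liftEnv, Cat.shift]
    rfl
  · simp [appArg, subst, subst_rename, rename_subst, Cat.liftEnv]

/-- The flags, which record whether the two parts are values, are kept apart from the commands
because `cps` must send an application of values directly to a call. A let-form there could not be
reached from the application, since the rules `ad₁` and `ad₂` need a non-value. -/
theorem appCps_subst (a : Bool) (P : Cps CpsSort.cmd) (V : Cps CpsSort.val) (b : Bool)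
    (Q : Cps CpsSort.cmd) (W : Cps CpsSort.val) (σ : ℕ → Cps CpsSort.val)
    (κ : ℕ → Cps CpsSort.cont) :
    subst (fun n => rename id Nat.succ (σ n)) (Cat.term.liftEnv κ) (appCps a P V b Q W) =
      appCps a (subst (fun n => rename id Nat.succ (σ n)) (Cat.term.liftEnv κ) P) (subst σ κ V) b
        (subst (fun n => rename id Nat.succ (σ n)) (Cat.term.liftEnv κ) Q) (subst σ κ W) := by
  cases a
  · simp only [appCps]
    refine (plug_subst Cat.term _ _ σ κ).trans ?_
    have h := appArg_subst (var 0) b (rename Nat.succ id Q) (rename Nat.succ id W)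
      (cons (var 0) fun n => rename Nat.succ id (σ n)) (fun n => rename Nat.succ id (κ n))
    simp only [subst, subst_rename, rename_subst, cons_zero] at h ⊢
    simp only [Bool.false_eq_true, if_false]
    congr 2
    convert h using 2
    · funext n; cases n <;> simp [rename, rename_rename, Cat.shift]
    · funext n; cases n <;> simp [rename, rename_rename, Cat.liftEnv] 
    · congr 1
      · funext n
        simp [rename_rename]
      · funext n
        cases n <;> simp [rename_rename, rename, Cat.liftEnv]
    · rfl
  · simp [appCps, appArg_subst]

end Cps

namespace Expr

open Cps (plug appArg appCps)

/-- The CPS translation of an expression, paired with its translation as a value, which is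
meaningful for values only. In the translation of a term, the continuation variable `0` is the
return continuation. -/
def cpsPair : {s : Cat} → Expr s → Cps CpsSort.cmd × Cps CpsSort.val
  | _, var x => (Cps.ret (Cps.cvar 0) (Cps.var x), Cps.var x)
  | _, lam M =>
      (Cps.ret (Cps.cvar 0) (Cps.rename id Nat.succ (Cps.lam (cpsPair M).1)),
        Cps.lam (cpsPair M).1)
  | _, app M N =>
      (appCps (isVal M) (cpsPair M).1 (cpsPair M).2 (isVal N) (cpsPair N).1 (cpsPair N).2,
        Cps.var 0)
  | s, letin L M => (plug s (cpsPair M).1 (Cps.kont (cpsPair L).1), Cps.var 0)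
  | _, mu J => ((cpsPair J).1, Cps.var 0)
  | _, jmp k M => (plug Cat.jump (cpsPair M).1 (Cps.cvar k), Cps.var 0)

/-- The CPS translation of an expression. -/
def cps {s : Cat} (A : Expr s) : Cps CpsSort.cmd := (cpsPair A).1

/-- The CPS translation of a value. -/
def cpsVal {s : Cat} (A : Expr s) : Cps CpsSort.val := (cpsPair A).2

theorem cps_lam (M : Expr Cat.term) :
    cps (lam M) = Cps.ret (Cps.cvar 0) (Cps.rename id Nat.succ (Cps.lam (cps M))) := rfl

theorem cps_app (M N : Expr Cat.term) : cps (app M N) =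
    appCps (isVal M) (cps M) (cpsVal M) (isVal N) (cps N) (cpsVal N) := rfl

theorem cps_letin {s : Cat} (L : Expr s) (M : Expr Cat.term) :
    cps (letin L M) = plug s (cps M) (Cps.kont (cps L)) := rfl

theorem cps_mu (J : Expr Cat.jump) : cps (mu J) = cps J := rfl

theorem cps_jmp (k : ℕ) (M : Expr Cat.term) :
    cps (jmp k M) = plug Cat.jump (cps M) (Cps.cvar k) := rfl

theorem cpsVal_var (x : ℕ) : cpsVal (var x) = Cps.var x := rfl

theorem cpsVal_lam (M : Expr Cat.term) : cpsVal (lam M) = Cps.lam (cps M) := rfl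

theorem cps_of_isVal {V : Expr Cat.term} (h : isVal V = true) :
    cps V = Cps.ret (Cps.cvar 0) (Cps.rename id Nat.succ (cpsVal V)) := by
  cases V <;> first | rfl | cases h

/-! ### Compatibility of the translation with renaming and substitution -/

/-- The translation of `A'` is the image of the translation of `A` under a substitution. -/
structure Image {s : Cat} (σ : ℕ → Cps CpsSort.val) (κ : ℕ → Cps CpsSort.cont)
    (A A' : Expr s) : Prop where
  isVal : isVal A' = isVal A
  cps : cps A' = Cps.subst (fun n => Cps.rename id s.shift (σ n)) (s.liftEnv κ) (cps A)
  cpsVal : A.isVal = true → cpsVal A' = Cps.subst σ κ (cpsVal A)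

namespace Image

variable {σ : ℕ → Cps CpsSort.val} {κ : ℕ → Cps CpsSort.cont}

theorem var {x : ℕ} {V : Expr Cat.term} (hV : V.isVal = true) (h : V.cpsVal = σ x) :
    Image σ κ (var x) V where
  isVal := hV
  cps := by rw [cps_of_isVal hV, h]; rfl
  cpsVal _ := h

theorem lam {M M' : Expr Cat.term}
    (h : Image (cons (Cps.var 0) fun n => Cps.rename Nat.succ id (σ n))
    (fun n => Cps.rename Nat.succ id (κ n)) M M') : Image σ κ (lam M) (lam M') := by
  have h' : (Expr.lam M').cpsVal = Cps.subst σ κ (Expr.lam M).cpsVal := by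
    simp only [cpsVal_lam, h.cps, Cps.subst]
    congr 2 <;> funext n <;> cases n <;>
      simp [Cat.liftEnv, Cps.rename, Cps.rename_rename] <;> rfl
  refine ⟨rfl, ?_, fun _ => h'⟩
  rw [cps_of_isVal (V := Expr.lam M') rfl, cps_of_isVal (V := Expr.lam M) rfl, h']
  simp [Cps.rename_subst, Cps.subst_rename, Cps.subst, Cat.liftEnv, Cat.shift]

theorem letin {s : Cat} {L L' : Expr s} {M M' : Expr Cat.term}
    (hL : Image (cons (Cps.var 0) fun n => Cps.rename Nat.succ id (σ n))
      (fun n => Cps.rename Nat.succ id (κ n)) L L')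
    (hM : Image σ κ M M') : Image σ κ (letin L M) (letin L' M') := by
  refine ⟨rfl, ?_, fun h => nomatch h⟩
  rw [cps_letin, cps_letin, Cps.plug_subst, hM.cps, hL.cps]
  congr 1
  simp only [Cps.subst]
  congr 2 <;> funext n
  · cases n <;> simp [Cps.rename, Cps.rename_rename]
  · cases s
    · cases n <;> simp [Cat.liftEnv, Cps.rename, Cps.rename_rename]
    · simp [Cat.liftEnv]

theorem app {M M' N N' : Expr Cat.term} (hM : Image σ κ M M') (hN : Image σ κ N N') :
    Image σ κ (app M N) (app M' N') := by
  refine ⟨rfl, ?_, fun h => nomatch h⟩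
  refine Eq.trans ?_ (Cps.appCps_subst _ _ _ _ _ _ σ κ).symm
  rw [cps_app, hM.isVal, hN.isVal, hM.cps, hN.cps]
  cases hM' : M.isVal <;> cases hN' : N.isVal <;>
    simp [appCps, appArg, hM.cpsVal, hN.cpsVal, hM', hN', Cat.shift] <;>
    first | rfl | exact ⟨rfl, rfl⟩

theorem mu {J J' : Expr Cat.jump} (h : Image (fun n => Cps.rename id Nat.succ (σ n))
    (Cat.term.liftEnv κ) J J') : Image σ κ (mu J) (mu J') := by
  refine ⟨rfl, ?_, fun h => nomatch h⟩
  rw [cps_mu, cps_mu, h.cps]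
  simp [Cat.shift, Cps.rename_rename]
  rfl

theorem jmp {k l : ℕ} {M M' : Expr Cat.term} (hk : κ k = Cps.cvar l) (h : Image σ κ M M') :
    Image σ κ (jmp k M) (jmp l M') := by
  refine ⟨rfl, ?_, fun h => nomatch h⟩
  rw [cps_jmp, cps_jmp, Cps.plug_subst, h.cps, ← hk]
  rfl

/-- The case of `[k]M` when `k` is replaced. Binding the result of `M` in `L` and returning to `k`
amounts to passing it to the continuation given by `L`, in which the return index `0` is redirected
to `k`; this is the renaming `cons k id`. -/
theorem jmp_letin {k : ℕ} {L M M' : Expr Cat.term}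
    (hk : κ k = Cps.kont (Cps.rename id (cons k id) (Expr.cps L))) (h : Image σ κ M M') :
    Image σ κ (Expr.jmp k M) (Expr.jmp k (Expr.letin L M')) := by
  refine ⟨rfl, ?_, fun h => nomatch h⟩
  have h' : Expr.cps M' = Cps.subst (fun n => Cps.rename id Nat.succ (σ n))
    (Cat.term.liftEnv κ) (Expr.cps M) := h.cps
  rw [cps_jmp, cps_jmp, Cps.plug_subst, ← h', cps_letin]
  simp only [Cps.plug, Cps.subst_subst, Cps.subst]
  congr 1
  funext n
  cases n with
  | zero =>
    simp only [cons_zero, Cps.subst, Cat.liftEnv, hk, Cps.rename_eq_subst]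
    congr 2 <;> funext n <;> cases n <;> rfl
  | succ n => rfl

end Image

theorem image_rename {s : Cat} (A : Expr s) (ρ κ : ℕ → ℕ) :
    Image (fun n => Cps.var (ρ n)) (fun n => Cps.cvar (κ n)) A (rename ρ κ A) := by
  induction A generalizing ρ κ with
  | var x => exact .var rfl rfl
  | lam M ih =>
    refine .lam ?_
    convert ih (up ρ) κ using 1
    · funext n; cases n <;> rfl
    · rfl
  | app M N ihM ihN => exact .app (ihM ρ κ) (ihN ρ κ)
  | letin L M ihL ihM =>
    refine .letin ?_ (ihM ρ κ)
    convert ihL (up ρ) κ using 1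
    · funext n; cases n <;> rfl
    · rfl
  | mu J ih =>
    refine .mu ?_
    convert ih ρ (up κ) using 1
    · rfl
    · funext n; cases n <;> rfl
  | jmp k M ih => exact .jmp rfl (ih ρ κ)

theorem cps_rename {s : Cat} (A : Expr s) (ρ κ : ℕ → ℕ) : cps (rename ρ κ A) =
    Cps.subst (fun n => Cps.var (ρ n)) (s.liftEnv fun n => Cps.cvar (κ n)) (cps A) :=
  (image_rename A ρ κ).cps

theorem isVal_rename {s : Cat} (A : Expr s) (ρ κ : ℕ → ℕ) : isVal (rename ρ κ A) = isVal A :=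
  (image_rename A ρ κ).isVal

theorem cpsVal_rename {V : Expr Cat.term} (hV : isVal V = true) (ρ κ : ℕ → ℕ) :
    cpsVal (rename ρ κ V) = Cps.rename ρ κ (cpsVal V) := by
  rw [Cps.rename_eq_subst]; exact (image_rename V ρ κ).cpsVal hV

theorem image_subst {s : Cat} (A : Expr s) {σ : ℕ → Expr Cat.term}
    (hσ : ∀ n, isVal (σ n) = true) :
    Image (fun n => cpsVal (σ n)) Cps.cvar A (subst σ A) := by
  have up_val : ∀ {σ : ℕ → Expr Cat.term}, (∀ n, isVal (σ n) = true) →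
      (∀ n, isVal (upSubst σ n) = true) ∧ (fun n => cpsVal (upSubst σ n)) =
        cons (Cps.var 0) fun n => Cps.rename Nat.succ id (cpsVal (σ n)) := by
    intro σ hσ
    constructor
    · rintro (_ | n)
      exacts [rfl, (isVal_rename _ _ _).trans (hσ n)]
    · funext n
      cases n
      exacts [rfl, cpsVal_rename (hσ _) _ _]
  induction A generalizing σ with
  | var x => exact .var (hσ x) rfl
  | lam M ih =>
    obtain ⟨h, h'⟩ := up_val hσ
    have := ih h
    rw [h'] at this
    exact .lam this
  | app M N ihM ihN => exact .app (ihM hσ) (ihN hσ)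
  | letin L M ihL ihM =>
    obtain ⟨h, h'⟩ := up_val hσ
    have := ihL h
    rw [h'] at this
    exact .letin this (ihM hσ)
  | mu J ih =>
    have := ih (σ := fun n => wkCont (σ n)) fun n => (isVal_rename _ _ _).trans (hσ n)
    refine .mu ?_
    convert this using 1
    · funext n; exact (cpsVal_rename (hσ n) _ _).symm
    · funext n; cases n <;> rfl
  | jmp k M ih => exact .jmp rfl (ih hσ)

/-- The structural substitution of `beta_mu` is, in the target, an ordinary substitution for one
continuation variable. The variable `k` itself may survive inside the substituted continuation. -/
theorem image_ctxSubst {s : Cat} (A : Expr s) (k : ℕ) (L : Expr Cat.term)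
    {κ : ℕ → Cps CpsSort.cont} (hk : κ k = Cps.kont (Cps.rename id (cons k id) (cps L)))
    (hκ : ∀ j, j ≠ k → κ j = Cps.cvar j) :
    Image Cps.var κ A (ctxSubst k L A) := by
  have hv : (cons (Cps.var 0) fun n => Cps.rename Nat.succ id (Cps.var n)) = Cps.var := by
    funext n; cases n <;> rfl
  have hwk : ∀ (k : ℕ) (L : Expr Cat.term) {κ : ℕ → Cps CpsSort.cont},
      κ k = Cps.kont (Cps.rename id (cons k id) (cps L)) → Cps.rename Nat.succ id (κ k) =
        Cps.kont (Cps.rename id (cons k id) (cps (wkVarUnder L))) := by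
    intro k L κ hk
    rw [hk, wkVarUnder, cps_rename]
    simp only [Cps.rename, Cps.rename_eq_subst, Cps.subst_subst]
    congr 2
    funext n; cases n <;> rfl
  induction A generalizing k L κ with
  | var x => exact .var rfl rfl
  | lam M ih =>
    refine .lam ?_
    rw [hv]
    exact ih k _ (hwk k L hk) fun j hj => by rw [hκ j hj]; rfl
  | app M N ihM ihN => exact .app (ihM k L hk hκ) (ihN k L hk hκ)
  | letin B M ihB ihM =>
    refine .letin ?_ (ihM k L hk hκ)
    rw [hv]
    exact ihB k _ (hwk k L hk) fun j hj => by rw [hκ j hj]; rfl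
  | mu J ih =>
    refine .mu ?_
    refine ih (k + 1) _ ?_ ?_
    · simp only [Cat.liftEnv, cons_succ]
      rw [hk, wkCont, cps_rename]
      simp only [Cps.rename, Cps.rename_eq_subst, Cps.subst_subst]
      congr 2 <;> funext n <;> cases n <;> rfl
    · rintro (_ | j) hj
      · rfl
      · simp only [Cat.liftEnv, cons_succ]
        rw [hκ j (by simpa using hj)]; rfl
  | jmp j M ih =>
    rw [ctxSubst]
    split_ifs with h
    · subst h
      exact .jmp_letin hk (ih j L hk hκ)
    · exact .jmp (hκ j h) (ih k L hk hκ)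

/-! ### Soundness: ccv-equal expressions have convertible translations -/

/-- Each axiom only regroups the order in which continuations are plugged in, and plugging is
substitution, which composes on the nose. -/
theorem Axm.cpsPair_eq {s : Cat} {A B : Expr s} (h : Axm A B) : cpsPair A = cpsPair B := by
  cases h with
  | assoc L M N =>
    refine Prod.ext ?_ rfl
    change cps _ = cps _
    simp only [cps_letin, wkVarUnder, cps_rename, Cps.plug, Cps.subst_subst, Cps.subst]
    congr 1
    funext n
    cases n with
    | zero =>
      simp only [cons_zero, Cps.subst]
      refine congrArg Cps.kont (Cps.subst_congr _ ?_ ?_) <;> rintro (_ | n) <;> try rfl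
      simp only [cons_zero, Cps.rename_eq_subst]
      refine congrArg Cps.kont (Cps.subst_congr _ ?_ ?_) <;> rintro (_ | n) <;> rfl
    | succ n => rfl
  | mu_let J M =>
    refine Prod.ext ?_ rfl
    change cps _ = cps _
    simp only [cps_letin, cps_mu, wkCont, cps_rename, Cps.plug, Cps.subst_subst]
    congr 1
    funext n; cases n <;> rfl
  | jmp_let k L M =>
    refine Prod.ext ?_ rfl
    change cps _ = cps _
    simp only [cps_letin, cps_jmp, Cps.plug, Cps.subst_subst, Cps.subst]
    congr 1
    funext n
    cases n with
    | zero =>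
      simp only [cons_zero, Cps.subst]
      congr 2 <;> funext n <;> cases n <;> rfl
    | succ n => rfl

/-- Being a value is carried along because the translation of an application depends on it. -/
theorem Ident.cpsPair_eq {s : Cat} {A B : Expr s} (h : Ident A B) :
    isVal A = isVal B ∧ cpsPair A = cpsPair B := by
  induction h with
  | axm h => exact ⟨by cases h <;> rfl, h.cpsPair_eq⟩
  | refl => exact ⟨rfl, rfl⟩
  | symm _ ih => exact ⟨ih.1.symm, ih.2.symm⟩
  | trans _ _ ih ih' => exact ⟨ih.1.trans ih'.1, ih.2.trans ih'.2⟩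
  | lam _ ih => simp [cpsPair, ih.2, isVal]
  | app _ _ ih ih' => exact ⟨rfl, by simp only [cpsPair, ih.1, ih.2, ih'.1, ih'.2]⟩
  | letin _ _ ih ih' => simp [cpsPair, ih.2, ih'.2, isVal]
  | mu _ ih => simp [cpsPair, ih.2, isVal]
  | jmp _ _ ih => simp [cpsPair, ih.2, isVal]

end Expr

namespace Cps

theorem Conv.of_eq {s : CpsSort} {A B : Cps s} (h : A = B) : Conv A B := ⟨B, steps_of_eq h, .refl⟩

theorem Steps.conv {s : CpsSort} {A B : Cps s} (h : Steps A B) : Conv A B := ⟨B, h, .refl⟩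

theorem Conv.symm {s : CpsSort} {A B : Cps s} (h : Conv A B) : Conv B A :=
  conv_equivalence.symm h

theorem Conv.trans {s : CpsSort} {A B C : Cps s} (h : Conv A B) (h' : Conv B C) : Conv A C :=
  conv_equivalence.trans h h'

theorem Conv.plug {s : Cat} {Q Q' : Cps CpsSort.cmd} {K K' : Cps CpsSort.cont} (hQ : Conv Q Q')
    (hK : Conv K K') : Conv (Cps.plug s Q K) (Cps.plug s Q' K') := by
  obtain ⟨Q₀, h₁, h₂⟩ := hQ
  obtain ⟨K₀, h₃, h₄⟩ := hK
  refine ⟨Cps.plug s Q₀ K₀, ?_, ?_⟩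
  · refine (h₁.subst _ _).trans (steps_subst_right _ (fun _ => .refl) ?_)
    rintro (_ | n)
    exacts [h₃, .refl]
  · refine (h₂.subst _ _).trans (steps_subst_right _ (fun _ => .refl) ?_)
    rintro (_ | n)
    exacts [h₄, .refl]

theorem Conv.kont {Q Q' : Cps CpsSort.cmd} (hQ : Conv Q Q') : Conv (kont Q) (kont Q') := by
  obtain ⟨Q₀, h₁, h₂⟩ := hQ
  exact ⟨_, h₁.kont, h₂.kont⟩

theorem Conv.rename {s : CpsSort} {A B : Cps s} (h : Conv A B) (r c : ℕ → ℕ) :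
    Conv (rename r c A) (rename r c B) := by
  obtain ⟨C, h₁, h₂⟩ := h
  exact ⟨_, h₁.rename r c, h₂.rename r c⟩

end Cps

namespace Expr

open Cps (plug appArg appCps)

theorem conv_appArg (V : Cps CpsSort.val) {b : Bool} {Q : Cps CpsSort.cmd} {W : Cps CpsSort.val}
    (h : b = true → Q = Cps.ret (Cps.cvar 0) (Cps.rename id Nat.succ W)) :
    Conv (appArg V b Q W) (plug Cat.term Q
      (Cps.kont (Cps.call (Cps.rename Nat.succ Nat.succ V) (Cps.var 0) (Cps.cvar 0)))) := by
  cases b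
  · exact .of_eq rfl
  · rw [h rfl]
    refine (Steps.conv (.single (Step.beta_ret _ _)) |>.trans (.of_eq ?_)).symm
    simp only [appArg, Cps.subst_rename, Cps.subst, if_true]
    simp [Cps.rename_eq_subst]
    rfl

/-- Conversion may turn a non-value into a value, so the case distinction in `cps` does not respect
it. This uniform form, with both arguments bound by continuations, makes convertibility a congruence
for application. -/
theorem conv_cps_app (M N : Expr Cat.term) : Conv (cps (app M N))
    (plug Cat.term (cps M) (Cps.kont (plug Cat.term (Cps.rename Nat.succ id (cps N))
      (Cps.kont (Cps.call (Cps.var 1) (Cps.var 0) (Cps.cvar 0)))))) := by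
  rw [cps_app, appCps]
  cases hM : isVal M
  · simp only [Bool.false_eq_true, if_false]
    refine (Conv.of_eq rfl).plug (Conv.kont ((conv_appArg _ fun h => ?_).trans (.of_eq rfl)))
    rw [cps_of_isVal h]
    simp only [Cps.rename, Cps.rename_rename]
    rfl
  · simp only [if_true]
    refine (conv_appArg _ cps_of_isVal).trans ?_
    rw [cps_of_isVal hM]
    refine (Steps.conv (.single (Step.beta_ret _ _)) |>.trans (.of_eq ?_)).symm
    simp only [plug, Cps.subst_rename, Cps.subst_subst, Cps.subst]
    refine Cps.subst_congr _ (fun _ => rfl) ?_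
    rintro (_ | n)
    · simp [Cps.subst, Cps.rename_eq_subst, Cps.subst_subst]
      rfl
    · rfl

/-- The rules `ad₁`, `ad₂`, `beta_mu`, `beta_jmp` and `eta_mu` become equalities. The two sides of
`beta_lam` meet after one β-step each, `beta_let` is one β-step, and `eta_lam` and `eta_let` come
from the η-rules for values and continuations. -/
theorem Rule.conv {s : Cat} {A B : Expr s} (h : Rule A B) : Conv (cps A) (cps B) := by
  cases h with
  | ad₁ N M hN =>
    have hN' : isVal N = false := by rw [← Bool.not_eq_true, isVal_iff]; exact hN
    refine .of_eq ?_
    rw [cps_app, cps_letin, cps_app, hN', wkVar, isVal_rename, cps_rename]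
    simp only [appCps, Bool.false_eq_true, if_false, if_true, isVal_var, cpsVal_var]
    congr 2
    cases hM : isVal M
    · simp only [appArg, Bool.false_eq_true, if_false, Cps.rename_eq_subst]
      refine congrArg (fun Q => plug _ Q _) (Cps.subst_congr _ (fun _ => rfl) ?_)
      rintro (_ | n) <;> rfl
    · rw [cpsVal_rename hM]; rfl
  | ad₂ V N hV hN =>
    have hN' : isVal N = false := by rw [← Bool.not_eq_true, isVal_iff]; exact hN
    have hV' := isVal_iff.2 hV
    refine .of_eq ?_
    rw [cps_app, cps_letin, cps_app, hN', hV', wkVar, isVal_rename, hV', cpsVal_rename hV']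
    simp [appCps, appArg, isVal_var, cpsVal_var, Cps.rename_rename]
    rfl
  | beta_lam M V hV =>
    have hV' := isVal_iff.2 hV
    rw [cps_app, cps_letin, hV', cps_of_isVal hV']
    refine (Steps.conv (.single (Step.beta_call _ _ _))).trans
      (.symm ((Steps.conv (.single (Step.beta_ret _ _))).trans (.of_eq ?_)))
    rw [Cps.subst_rename]
    refine ((Cps.subst_rename (cps M) _ _ _ _).trans
      (Cps.subst_congr _ ?_ ?_)).symm <;> rintro (_ | n) <;> try rfl
    exact Cps.rename_eq_subst _ _ _
  | beta_let M V hV =>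
    have hV' := isVal_iff.2 hV
    rw [cps_letin, cps_of_isVal hV']
    refine (Steps.conv (.single (Step.beta_ret _ _))).trans (.of_eq ?_)
    rw [inst, (image_subst M (σ := single V) (by rintro (_ | n); exacts [hV', rfl])).cps]
    refine Cps.subst_congr _ ?_ ?_ <;> rintro (_ | n) <;> try rfl
    simp only [cons_zero, Cps.rename_eq_subst, Cps.subst_subst]
    rfl
  | beta_mu M J =>
    refine .of_eq ?_
    -- Index `0` has two roles: in `J` it is the variable bound by `μ`, and inside `cps M` it is the
    -- return continuation of the whole let. Hence the other variables keep their successor indices.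
    rw [cps_letin, cps_mu, cps_mu, (image_ctxSubst J 0 (wkCont M)
      (κ := cons (Cps.kont (cps M)) fun n => Cps.cvar (n + 1)) ?_ ?_).cps]
    · rfl
    · rw [wkCont, cps_rename]
      simp only [Cps.rename_eq_subst, Cps.subst_subst, cons_zero]
      congr 1
      refine (Cps.subst_eq_self _ (fun _ => rfl) ?_).symm
      rintro (_ | n) <;> rfl
    · rintro (_ | j) hj
      exacts [absurd rfl hj, rfl]
  | beta_jmp l J =>
    refine .of_eq ?_
    rw [cps_jmp, cps_mu, instCont, cps_rename]
    simp only [plug]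
    congr 1
    funext n; cases n <;> rfl
  | eta_lam V hV =>
    have hV' := isVal_iff.2 hV
    rw [cps_of_isVal (V := lam _) rfl, cps_of_isVal hV', cpsVal_lam, cps_app, wkVar,
      isVal_rename, hV', cpsVal_rename hV']
    simp only [appCps, appArg, isVal_var, if_true, cpsVal_var, Cps.rename_rename, Cps.rename]
    refine Steps.conv (Steps.ret .refl ?_)
    convert (Cps.steps_eta_val (cpsVal V)).rename id Nat.succ using 1
    simp only [Cps.rename, Cps.rename_rename]
    rfl
  | eta_let M =>
    rw [cps_letin]
    refine Steps.conv (.trans (Cps.steps_subst_right _ (σ' := Cps.var) (κ' := Cps.cvar)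
      (fun _ => .refl) ?_) (Cps.steps_of_eq (Cps.subst_id _)))
    rintro (_ | n)
    · exact .single (Step.eta_cont 0)
    · exact .refl
  | eta_mu M =>
    refine .of_eq ?_
    rw [cps_mu, cps_jmp, wkCont, cps_rename, plug, Cps.subst_subst]
    refine Cps.subst_eq_self _ (fun _ => rfl) ?_
    rintro (_ | n) <;> rfl

end Expr

namespace Exp

/-- The CPS translation on classes. -/
def cps {s : Cat} : Exp s → Cps CpsSort.cmd :=
  Quotient.lift Expr.cps fun _ _ h => congrArg Prod.fst (Expr.Ident.cpsPair_eq h).2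

end Exp

theorem CcvEq.conv {s : Cat} {A B : Exp s} (h : CcvEq A B) : Conv A.cps B.cps := by
  induction h with
  | rule h => exact h.conv
  | refl => exact .of_eq rfl
  | symm _ ih => exact ih.symm
  | trans _ _ ih ih' => exact ih.trans ih'
  | @lam M M' _ ih =>
    induction M using Quotient.inductionOn
    induction M' using Quotient.inductionOn
    obtain ⟨Q, h₁, h₂⟩ := ih
    exact ⟨_, Steps.ret .refl (Steps.rename (Steps.lam h₁) id Nat.succ),
      Steps.ret .refl (Steps.rename (Steps.lam h₂) id Nat.succ)⟩
  | @app M M' N N' _ _ ih ih' =>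
    induction M using Quotient.inductionOn
    induction M' using Quotient.inductionOn
    induction N using Quotient.inductionOn
    induction N' using Quotient.inductionOn
    exact (Expr.conv_cps_app _ _).trans ((ih.plug ((ih'.rename _ _).plug (.of_eq rfl)).kont).trans
      (Expr.conv_cps_app _ _).symm)
  | @letin _ L L' M M' _ _ ih ih' =>
    induction M using Quotient.inductionOn
    induction M' using Quotient.inductionOn
    induction L using Quotient.inductionOn
    induction L' using Quotient.inductionOn
    exact ih'.plug ih.kont
  | @mu J J' _ ih =>
    induction J using Quotient.inductionOn
    induction J' using Quotient.inductionOn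
    exact ih
  | @jmp k M M' _ ih =>
    induction M using Quotient.inductionOn
    induction M' using Quotient.inductionOn
    exact ih.plug (.of_eq rfl)

/-! ### Renaming and free continuation variables in the source calculus -/

namespace Expr

theorem rename_rename {s : Cat} (A : Expr s) (ρ ρ' κ κ' : ℕ → ℕ) :
    rename ρ κ (rename ρ' κ' A) = rename (ρ ∘ ρ') (κ ∘ κ') A := by
  induction A generalizing ρ ρ' κ κ' <;> simp_all [rename, up_comp]

@[simp] theorem rename_id {s : Cat} (A : Expr s) : rename id id A = A := by
  induction A <;> simp_all [rename]

theorem rename_subst {s : Cat} (A : Expr s) {ρ ρ' κ : ℕ → ℕ} {σ σ' : ℕ → Expr Cat.term}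
    (h : ∀ n, rename ρ κ (σ n) = σ' (ρ' n)) :
    rename ρ κ (subst σ A) = subst σ' (rename ρ' κ A) := by
  have up_comm : ∀ {ρ ρ' κ : ℕ → ℕ} {σ σ' : ℕ → Expr Cat.term},
      (∀ n, rename ρ κ (σ n) = σ' (ρ' n)) →
        ∀ n, rename (up ρ) κ (upSubst σ n) = upSubst σ' (up ρ' n) := by
    rintro ρ ρ' κ σ σ' h (_ | n)
    · rfl
    · simp only [upSubst, up_succ, ← h, wkVar, rename_rename]
      rfl
  induction A generalizing ρ ρ' κ σ σ' with
  | var x => exact h x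
  | lam M ih => simp only [subst, rename, ih (up_comm h)]
  | app M N ihM ihN => simp only [subst, rename, ihM h, ihN h]
  | letin L M ihL ihM => simp only [subst, rename, ihL (up_comm h), ihM h]
  | mu J ih =>
    simp only [subst, rename]
    congr 1
    refine ih fun n => ?_
    simp only [← h, wkCont, rename_rename]
    rfl
  | jmp k M ih => simp only [subst, rename, ih h]

theorem rename_inst {s : Cat} (A : Expr s) (V : Expr Cat.term) (ρ κ : ℕ → ℕ) :
    rename ρ κ (inst A V) = inst (rename (up ρ) κ A) (rename ρ κ V) :=
  rename_subst A (by rintro (_ | n) <;> rfl)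

theorem rename_ctxSubst {s : Cat} (A : Expr s) {k k' : ℕ} (L : Expr Cat.term) (ρ : ℕ → ℕ)
    {κ : ℕ → ℕ} (h : ∀ j, κ j = k' ↔ j = k) :
    rename ρ κ (ctxSubst k L A) = ctxSubst k' (rename (up ρ) κ L) (rename ρ κ A) := by
  have under : ∀ (L : Expr Cat.term) (ρ κ : ℕ → ℕ),
      rename (up (up ρ)) κ (wkVarUnder L) = wkVarUnder (rename (up ρ) κ L) := by
    intro L ρ κ
    simp only [wkVarUnder, rename_rename, up_comp]
    rfl
  induction A generalizing k k' L ρ κ with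
  | var x => rfl
  | lam M ih => simp only [ctxSubst, rename, ih _ _ h, under]
  | app M N ihM ihN => simp only [ctxSubst, rename, ihM _ _ h, ihN _ _ h]
  | letin B M ihB ihM => simp only [ctxSubst, rename, ihB _ _ h, ihM _ _ h, under]
  | mu J ih =>
    have h' : ∀ j, up κ j = k' + 1 ↔ j = k + 1 := by
      rintro (_ | j) <;> simp [h]
    simp only [ctxSubst, rename, ih _ _ h', wkCont, rename_rename]
    rfl
  | jmp j M ih =>
    simp only [ctxSubst, rename, h]
    split_ifs <;> simp [rename, ih _ _ h]

theorem rename_instCont (J : Expr Cat.jump) (l : ℕ) (ρ κ : ℕ → ℕ) :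
    rename ρ κ (instCont J l) = instCont (rename ρ (up κ) J) (κ l) := by
  simp only [instCont, rename_rename]
  congr 1
  funext n; cases n <;> rfl

theorem rename_wkVar {s : Cat} (A : Expr s) (ρ κ : ℕ → ℕ) :
    rename (up ρ) κ (wkVar A) = wkVar (rename ρ κ A) := by
  simp only [wkVar, rename_rename]; rfl

theorem rename_wkCont {s : Cat} (A : Expr s) (ρ κ : ℕ → ℕ) :
    rename ρ (up κ) (wkCont A) = wkCont (rename ρ κ A) := by
  simp only [wkCont, rename_rename]; rfl

theorem Axm.rename {s : Cat} {A B : Expr s} (h : Axm A B) (ρ κ : ℕ → ℕ) :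
    Axm (rename ρ κ A) (rename ρ κ B) := by
  cases h with
  | assoc L M N =>
    have h := Axm.assoc (Expr.rename (up ρ) κ L) (Expr.rename (up ρ) κ M) (Expr.rename ρ κ N)
    simp only [wkVarUnder, rename_rename, up_comp] at h
    simp only [Expr.rename, wkVarUnder, rename_rename, up_comp]
    exact h
  | mu_let J M =>
    simp only [Expr.rename, rename_wkCont]
    exact .mu_let _ _
  | jmp_let k L M => exact .jmp_let _ _ _

theorem Ident.rename {s : Cat} {A B : Expr s} (h : Ident A B) (ρ κ : ℕ → ℕ) :
    Ident (rename ρ κ A) (rename ρ κ B) := by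
  induction h generalizing ρ κ with
  | axm h => exact .axm (h.rename ρ κ)
  | refl => exact .refl _
  | symm _ ih => exact (ih ρ κ).symm
  | trans _ _ ih ih' => exact (ih ρ κ).trans (ih' ρ κ)
  | lam _ ih => exact (ih _ _).lam
  | app _ _ ih ih' => exact (ih _ _).app (ih' _ _)
  | letin _ _ ih ih' => exact (ih _ _).letin (ih' _ _)
  | mu _ ih => exact (ih _ _).mu
  | jmp _ _ ih => exact (ih _ _).jmp _

theorem isValue_rename {M : Expr Cat.term} (ρ κ : ℕ → ℕ) : IsValue (rename ρ κ M) ↔ IsValue M := by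
  rw [← isVal_iff, ← isVal_iff, isVal_rename]

theorem Rule.rename {s : Cat} {A B : Expr s} (h : Rule A B) (ρ κ : ℕ → ℕ) :
    Rule (rename ρ κ A) (rename ρ κ B) := by
  cases h with
  | ad₁ N M hN =>
    simp only [Expr.rename, rename_wkVar, up_zero]
    exact .ad₁ _ _ (by rwa [isValue_rename])
  | ad₂ V N hV hN =>
    simp only [Expr.rename, rename_wkVar, up_zero]
    exact .ad₂ _ _ (by rwa [isValue_rename]) (by rwa [isValue_rename])
  | beta_lam M V hV => exact .beta_lam _ _ (by rwa [isValue_rename])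
  | beta_let M V hV =>
    rw [rename_inst]
    exact .beta_let _ _ (by rwa [isValue_rename])
  | beta_mu M J =>
    simp only [Expr.rename]
    rw [rename_ctxSubst J (k' := 0) _ _ (by rintro (_ | j) <;> simp), rename_wkCont]
    exact .beta_mu _ _
  | beta_jmp l J =>
    rw [rename_instCont]
    exact .beta_jmp _ _
  | eta_lam V hV =>
    simp only [Expr.rename, rename_wkVar, up_zero]
    exact .eta_lam _ (by rwa [isValue_rename])
  | eta_let M => exact .eta_let _
  | eta_mu M =>
    simp only [Expr.rename, rename_wkCont, up_zero]
    exact .eta_mu _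

/-- The continuation variable `k` is free in the expression. -/
def FreeCont : {s : Cat} → ℕ → Expr s → Prop
  | _, _, var _ => False
  | _, k, lam M => FreeCont k M
  | _, k, app M N => FreeCont k M ∨ FreeCont k N
  | _, k, letin L M => FreeCont k L ∨ FreeCont k M
  | _, k, mu J => FreeCont (k + 1) J
  | _, k, jmp j M => j = k ∨ FreeCont k M

theorem freeCont_rename {s : Cat} (A : Expr s) (k : ℕ) (ρ κ : ℕ → ℕ) :
    FreeCont k (rename ρ κ A) ↔ ∃ j, κ j = k ∧ FreeCont j A := by
  induction A generalizing k ρ κ with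
  | var x => simp [rename, FreeCont]
  | lam M ih => simp [rename, FreeCont, ih]
  | app M N ihM ihN => simp [rename, FreeCont, ihM, ihN, and_or_left, exists_or]
  | letin L M ihL ihM => simp [rename, FreeCont, ihL, ihM, and_or_left, exists_or]
  | mu J ih =>
    simp only [rename, FreeCont, ih]
    constructor
    · rintro ⟨_ | j, h, h'⟩
      · simp at h
      · exact ⟨j, by simpa using h, h'⟩
    · rintro ⟨j, rfl, h⟩
      exact ⟨j + 1, rfl, h⟩
  | jmp j M ih => simp [rename, FreeCont, ih, and_or_left, exists_or]

@[simp] theorem freeCont_wkVar {s : Cat} (A : Expr s) (k : ℕ) :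
    FreeCont k (wkVar A) ↔ FreeCont k A := by
  simp [wkVar, freeCont_rename]

@[simp] theorem freeCont_wkVarUnder {s : Cat} (A : Expr s) (k : ℕ) :
    FreeCont k (wkVarUnder A) ↔ FreeCont k A := by
  simp [wkVarUnder, freeCont_rename]

@[simp] theorem freeCont_wkCont_succ {s : Cat} (A : Expr s) (k : ℕ) :
    FreeCont (k + 1) (wkCont A) ↔ FreeCont k A := by
  simp [wkCont, freeCont_rename]

@[simp] theorem freeCont_wkCont_zero {s : Cat} (A : Expr s) : ¬ FreeCont 0 (wkCont A) := by
  simp [wkCont, freeCont_rename]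

theorem rename_congr {s : Cat} (A : Expr s) (ρ : ℕ → ℕ) {κ κ' : ℕ → ℕ}
    (h : ∀ k, FreeCont k A → κ k = κ' k) : rename ρ κ A = rename ρ κ' A := by
  induction A generalizing ρ κ κ' with
  | var x => rfl
  | lam M ih => simp only [rename, ih _ h]
  | app M N ihM ihN =>
    simp only [rename, ihM _ fun k hk => h k (.inl hk), ihN _ fun k hk => h k (.inr hk)]
  | letin L M ihL ihM =>
    simp only [rename, ihL _ fun k hk => h k (.inl hk), ihM _ fun k hk => h k (.inr hk)]
  | mu J ih =>
    simp only [rename]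
    congr 1
    refine ih _ ?_
    rintro (_ | k) hk
    · rfl
    · simp [h k hk]
  | jmp j M ih => simp only [rename, ih _ fun k hk => h k (.inr hk), h j (.inl rfl)]

/-- Lower the continuation variables by one. -/
def lowerCont {s : Cat} (A : Expr s) : Expr s := rename id Nat.pred A

@[simp] theorem lowerCont_wkCont {s : Cat} (A : Expr s) : lowerCont (wkCont A) = A := by
  rw [lowerCont, wkCont, rename_rename]; exact rename_id A

theorem wkCont_lowerCont {s : Cat} {A : Expr s} (h : ¬ FreeCont 0 A) :
    wkCont (lowerCont A) = A := by
  rw [lowerCont, wkCont, rename_rename]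
  conv_rhs => rw [← rename_id A]
  refine rename_congr A id ?_
  rintro (_ | k) hk
  exacts [absurd hk h, rfl]

theorem Axm.freeCont {s : Cat} {A B : Expr s} (h : Axm A B) (k : ℕ) :
    FreeCont k A ↔ FreeCont k B := by
  cases h with
  | assoc L M N => simp [FreeCont, or_assoc]
  | mu_let J M => simp [FreeCont]
  | jmp_let j L M => simp [FreeCont, or_assoc]

theorem Ident.freeCont {s : Cat} {A B : Expr s} (h : Ident A B) (k : ℕ) :
    FreeCont k A ↔ FreeCont k B := by
  induction h generalizing k with
  | axm h => exact h.freeCont k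
  | refl => rfl
  | symm _ ih => exact (ih k).symm
  | trans _ _ ih ih' => exact (ih k).trans (ih' k)
  | lam _ ih => exact ih k
  | app _ _ ih ih' => exact or_congr (ih k) (ih' k)
  | letin _ _ ih ih' => exact or_congr (ih k) (ih' k)
  | mu _ ih => exact ih (k + 1)
  | jmp _ _ ih => exact or_congr .rfl (ih k)

theorem freeCont_of_subst {s : Cat} (A : Expr s) {k : ℕ} {σ : ℕ → Expr Cat.term}
    (hσ : ∀ n, ¬ FreeCont k (σ n)) (h : FreeCont k (subst σ A)) : FreeCont k A := by
  have up_free : ∀ {k : ℕ} {σ : ℕ → Expr Cat.term}, (∀ n, ¬ FreeCont k (σ n)) →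
      ∀ n, ¬ FreeCont k (upSubst σ n) := by
    rintro k σ h (_ | n)
    exacts [fun h => h, (freeCont_wkVar _ _).not.2 (h n)]
  induction A generalizing k σ with
  | var x => exact hσ x h
  | lam M ih => exact ih (up_free hσ) h
  | app M N ihM ihN => exact h.imp (ihM hσ) (ihN hσ)
  | letin L M ihL ihM => exact h.imp (ihL (up_free hσ)) (ihM hσ)
  | mu J ih => exact ih (fun n => (freeCont_wkCont_succ _ _).not.2 (hσ n)) h
  | jmp j M ih => exact h.imp id (ih hσ)

theorem freeCont_of_inst {s : Cat} {A : Expr s} {V : Expr Cat.term} {k : ℕ}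
    (h : FreeCont k (inst A V)) : FreeCont k A ∨ FreeCont k V := by
  by_contra! h'
  refine h'.1 (freeCont_of_subst A ?_ h)
  rintro (_ | n)
  exacts [h'.2, fun h => h]

theorem freeCont_of_ctxSubst {s : Cat} (A : Expr s) {i k : ℕ} {L : Expr Cat.term}
    (hL : ¬ FreeCont i L) (h : FreeCont i (ctxSubst k L A)) : FreeCont i A := by
  induction A generalizing i k L with
  | var x => exact h
  | lam M ih => exact ih ((freeCont_wkVarUnder _ _).not.2 hL) h
  | app M N ihM ihN => exact h.imp (ihM hL) (ihN hL)
  | letin B M ihB ihM => exact h.imp (ihB ((freeCont_wkVarUnder _ _).not.2 hL)) (ihM hL)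
  | mu J ih => exact ih ((freeCont_wkCont_succ _ _).not.2 hL) h
  | jmp j M ih =>
    rw [ctxSubst] at h
    split_ifs at h
    · exact h.imp id fun h => ih hL (h.resolve_left hL)
    · exact h.imp id (ih hL)

/-- Reduction creates no free continuation variable, so the side condition of `eta_mu` persists when
the body is reduced. -/
theorem Rule.freeCont {s : Cat} {A B : Expr s} (h : Rule A B) {k : ℕ} (hB : FreeCont k B) :
    FreeCont k A := by
  cases h with
  | ad₁ N M hN => simpa [FreeCont, or_comm] using hB
  | ad₂ V N hV hN => simpa [FreeCont] using hB
  | beta_lam M V hV => exact hB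
  | beta_let M V hV => exact freeCont_of_inst hB
  | beta_mu M J =>
    by_cases hM : FreeCont k M
    · exact .inl hM
    · exact .inr (freeCont_of_ctxSubst J ((freeCont_wkCont_succ _ _).not.2 hM) hB)
  | beta_jmp l J =>
    obtain ⟨_ | j, rfl, h⟩ := (freeCont_rename J k id _).1 hB
    · exact .inl rfl
    · exact .inr h
  | eta_lam V hV => simpa [FreeCont] using hB
  | eta_let M => exact .inr hB
  | eta_mu M => simpa [FreeCont] using hB

end Expr

namespace Exp

/-- Renaming on classes. -/
def rename {s : Cat} (ρ κ : ℕ → ℕ) : Exp s → Exp s :=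
  Quotient.map (Expr.rename ρ κ) fun _ _ h => Expr.Ident.rename h ρ κ

/-- The continuation variable `k` is free in the class. -/
def FreeCont {s : Cat} (k : ℕ) : Exp s → Prop :=
  Quotient.lift (Expr.FreeCont k) fun _ _ h => propext (Expr.Ident.freeCont h k)

end Exp

theorem Red.rename {s : Cat} {A B : Exp s} (h : Red A B) (ρ κ : ℕ → ℕ) :
    Red (A.rename ρ κ) (B.rename ρ κ) := by
  induction h generalizing ρ κ with
  | rule h => exact .rule (h.rename ρ κ)
  | @lam M M' _ ih =>
    induction M using Quotient.inductionOn
    induction M' using Quotient.inductionOn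
    exact .lam (ih (Expr.up ρ) κ)
  | @app_left M M' N _ ih =>
    induction M using Quotient.inductionOn
    induction M' using Quotient.inductionOn
    induction N using Quotient.inductionOn
    exact .app_left (Exp.rename ρ κ (Exp.mk _)) (ih ρ κ)
  | @app_right M N N' _ ih =>
    induction M using Quotient.inductionOn
    induction N using Quotient.inductionOn
    induction N' using Quotient.inductionOn
    exact .app_right (Exp.rename ρ κ (Exp.mk _)) (ih ρ κ)
  | @let_left s L L' M _ ih =>
    induction L using Quotient.inductionOn
    induction L' using Quotient.inductionOn
    induction M using Quotient.inductionOn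
    exact .let_left (Exp.rename ρ κ (Exp.mk _)) (ih (Expr.up ρ) κ)
  | @let_right s L M M' _ ih =>
    induction L using Quotient.inductionOn
    induction M using Quotient.inductionOn
    induction M' using Quotient.inductionOn
    exact .let_right (Exp.rename (Expr.up ρ) κ (Exp.mk _)) (ih ρ κ)
  | @mu J J' _ ih =>
    induction J using Quotient.inductionOn
    induction J' using Quotient.inductionOn
    exact .mu (ih ρ (Expr.up κ))
  | @jmp k M M' _ ih =>
    induction M using Quotient.inductionOn
    induction M' using Quotient.inductionOn
    exact .jmp _ (ih ρ κ)

theorem Red.freeCont {s : Cat} {A B : Exp s} (h : Red A B) {k : ℕ} (hB : B.FreeCont k) :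
    A.FreeCont k := by
  induction h generalizing k with
  | rule h => exact h.freeCont hB
  | @lam M M' _ ih =>
    induction M using Quotient.inductionOn
    induction M' using Quotient.inductionOn
    exact ih hB
  | @app_left M M' N _ ih =>
    induction M using Quotient.inductionOn
    induction M' using Quotient.inductionOn
    induction N using Quotient.inductionOn
    exact Or.imp_left ih hB
  | @app_right M N N' _ ih =>
    induction M using Quotient.inductionOn
    induction N using Quotient.inductionOn
    induction N' using Quotient.inductionOn
    exact Or.imp_right ih hB
  | @let_left s L L' M _ ih =>
    induction L using Quotient.inductionOn
    induction L' using Quotient.inductionOn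
    induction M using Quotient.inductionOn
    exact Or.imp_left ih hB
  | @let_right s L M M' _ ih =>
    induction L using Quotient.inductionOn
    induction M using Quotient.inductionOn
    induction M' using Quotient.inductionOn
    exact Or.imp_right ih hB
  | @mu J J' _ ih =>
    induction J using Quotient.inductionOn
    induction J' using Quotient.inductionOn
    exact ih (k := k + 1) hB
  | @jmp j M M' _ ih =>
    induction M using Quotient.inductionOn
    induction M' using Quotient.inductionOn
    exact Or.imp_right ih hB

/-! ### Many-step reduction on representatives -/

namespace Expr

/-- Many-step reduction between representatives. -/
def Reds {s : Cat} (A B : Expr s) : Prop := CCV.Reds (Exp.mk A) (Exp.mk B)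

namespace Reds

theorem refl {s : Cat} (A : Expr s) : Reds A A := Relation.ReflTransGen.refl

theorem trans {s : Cat} {A B C : Expr s} (h : Reds A B) (h' : Reds B C) : Reds A C :=
  Relation.ReflTransGen.trans h h'

theorem of_eq {s : Cat} {A B : Expr s} (h : A = B) : Reds A B := h ▸ refl A

theorem of_ident {s : Cat} {A B : Expr s} (h : Ident A B) : Reds A B := by
  rw [Reds, show Exp.mk A = Exp.mk B from Quotient.sound h]
  exact Relation.ReflTransGen.refl

theorem of_rule {s : Cat} {A B : Expr s} (h : Rule A B) : Reds A B :=
  Relation.ReflTransGen.single (Red.rule h)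

theorem lam {M M' : Expr Cat.term} (h : Reds M M') : Reds (lam M) (lam M') :=
  Relation.ReflTransGen.lift Exp.lam (fun _ _ => Red.lam) _ _ h

theorem app {M M' N N' : Expr Cat.term} (h : Reds M M') (h' : Reds N N') :
    Reds (app M N) (app M' N') :=
  .trans (B := Expr.app M' N)
    (Relation.ReflTransGen.lift (fun M => Exp.app M (Exp.mk N)) (fun _ _ => Red.app_left _) _ _ h)
    (Relation.ReflTransGen.lift (fun N => Exp.app (Exp.mk M') N) (fun _ _ => Red.app_right _)
      _ _ h')

theorem letin {s : Cat} {L L' : Expr s} {M M' : Expr Cat.term} (h : Reds L L') (h' : Reds M M') :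
    Reds (letin L M) (letin L' M') :=
  .trans (B := Expr.letin L' M)
    (Relation.ReflTransGen.lift (fun L => Exp.letin L (Exp.mk M)) (fun _ _ => Red.let_left _) _ _ h)
    (Relation.ReflTransGen.lift (fun M => Exp.letin (Exp.mk L') M) (fun _ _ => Red.let_right _)
      _ _ h')

theorem mu {J J' : Expr Cat.jump} (h : Reds J J') : Reds (mu J) (mu J') :=
  Relation.ReflTransGen.lift Exp.mu (fun _ _ => Red.mu) _ _ h

theorem jmp (k : ℕ) {M M' : Expr Cat.term} (h : Reds M M') : Reds (jmp k M) (jmp k M') :=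
  Relation.ReflTransGen.lift (Exp.jmp k) (fun _ _ => Red.jmp k) _ _ h

theorem rename {s : Cat} {A B : Expr s} (h : Reds A B) (ρ κ : ℕ → ℕ) :
    Reds (rename ρ κ A) (rename ρ κ B) :=
  Relation.ReflTransGen.lift (Exp.rename ρ κ) (fun _ _ h => Red.rename h ρ κ) _ _ h

theorem freeCont {s : Cat} {A B : Expr s} (h : Reds A B) {k : ℕ} (hB : FreeCont k B) :
    FreeCont k A := by
  change (Exp.mk A).FreeCont k
  change (Exp.mk B).FreeCont k at hB
  unfold Reds at h
  generalize Exp.mk A = A' at *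
  generalize Exp.mk B = B' at *
  induction h with
  | refl => exact hB
  | tail _ h ih => exact ih (h.freeCont hB)

end Reds

end Expr


/-! ### Jump contexts and their substitution for continuation variables -/

/-- Jump contexts `[k]□` and `J⟨x := □⟩`. -/
inductive Ctx : Type
  | jump (k : ℕ)
  | bind (J : Expr Cat.jump)

namespace Ctx

/-- Fill the hole of a context. -/
def fill : Ctx → Expr Cat.term → Expr Cat.jump
  | jump k, M => Expr.jmp k M
  | bind J, M => Expr.letin J M

/-- Renaming of contexts. -/
def rename (ρ κ : ℕ → ℕ) : Ctx → Ctx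
  | jump k => jump (κ k)
  | bind J => bind (Expr.rename (Expr.up ρ) κ J)

/-- The continuation variable `k` is free in the context. -/
def FreeCont (k : ℕ) : Ctx → Prop
  | jump j => j = k
  | bind J => Expr.FreeCont k J

theorem rename_fill (C : Ctx) (M : Expr Cat.term) (ρ κ : ℕ → ℕ) :
    Expr.rename ρ κ (C.fill M) = (C.rename ρ κ).fill (Expr.rename ρ κ M) := by
  cases C <;> rfl

theorem rename_rename (C : Ctx) (ρ ρ' κ κ' : ℕ → ℕ) :
    rename ρ κ (rename ρ' κ' C) = rename (ρ ∘ ρ') (κ ∘ κ') C := by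
  cases C <;> simp [rename, Expr.rename_rename, Expr.up_comp]

theorem freeCont_rename (C : Ctx) (k : ℕ) (ρ κ : ℕ → ℕ) :
    FreeCont k (rename ρ κ C) ↔ ∃ j, κ j = k ∧ FreeCont j C := by
  cases C <;> simp [rename, FreeCont, Expr.freeCont_rename]

theorem freeCont_fill (C : Ctx) (M : Expr Cat.term) (k : ℕ) :
    Expr.FreeCont k (C.fill M) ↔ C.FreeCont k ∨ Expr.FreeCont k M := by
  cases C <;> rfl

end Ctx

namespace Expr

/-- Simultaneous substitution of terms for ordinary variables and of jump contexts for
continuation variables. -/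
def ctxInst : {s : Cat} → (ℕ → Expr Cat.term) → (ℕ → Ctx) → Expr s → Expr s
  | _, σ, _, var x => σ x
  | _, σ, κ, lam M => lam (ctxInst (upSubst σ) (fun n => (κ n).rename Nat.succ id) M)
  | _, σ, κ, app M N => app (ctxInst σ κ M) (ctxInst σ κ N)
  | _, σ, κ, letin L M =>
      letin (ctxInst (upSubst σ) (fun n => (κ n).rename Nat.succ id) L) (ctxInst σ κ M)
  | _, σ, κ, mu J =>
      mu (ctxInst (fun n => wkCont (σ n))
        (cons (Ctx.jump 0) fun n => (κ n).rename id Nat.succ) J)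
  | _, σ, κ, jmp k M => (κ k).fill (ctxInst σ κ M)

theorem rename_eq_ctxInst {s : Cat} (A : Expr s) (ρ κ : ℕ → ℕ) :
    rename ρ κ A = ctxInst (fun n => var (ρ n)) (fun n => Ctx.jump (κ n)) A := by
  have up_var : ∀ ρ : ℕ → ℕ, upSubst (fun n => var (ρ n)) = fun n => var (up ρ n) := by
    intro ρ; funext n; cases n <;> rfl
  induction A generalizing ρ κ with
  | var x => rfl
  | lam M ih => simp only [rename, ctxInst, ih, up_var, Ctx.rename, id]
  | app M N ihM ihN => simp only [rename, ctxInst, ihM, ihN]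
  | letin L M ihL ihM => simp only [rename, ctxInst, ihL, ihM, up_var, Ctx.rename, id]
  | mu J ih =>
    simp only [rename, ctxInst, ih]
    congr 2
    funext n; cases n <;> rfl
  | jmp k M ih => simp only [rename, ctxInst, ih, Ctx.fill]

theorem subst_eq_ctxInst {s : Cat} (A : Expr s) (σ : ℕ → Expr Cat.term) :
    subst σ A = ctxInst σ Ctx.jump A := by
  induction A generalizing σ with
  | var x => rfl
  | lam M ih => simp only [subst, ctxInst, ih]; rfl
  | app M N ihM ihN => simp only [subst, ctxInst, ihM, ihN]
  | letin L M ihL ihM => simp only [subst, ctxInst, ihL, ihM]; rfl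
  | mu J ih =>
    simp only [subst, ctxInst, ih]
    congr 2
    funext n; cases n <;> rfl
  | jmp k M ih => simp only [subst, ctxInst, ih, Ctx.fill]

theorem ctxInst_rename {s : Cat} (A : Expr s) (σ : ℕ → Expr Cat.term) (κ : ℕ → Ctx)
    (r c : ℕ → ℕ) :
    ctxInst σ κ (rename r c A) = ctxInst (fun n => σ (r n)) (fun n => κ (c n)) A := by
  have up_comp' : ∀ (σ : ℕ → Expr Cat.term) (r : ℕ → ℕ),
      (fun n => upSubst σ (up r n)) = upSubst fun n => σ (r n) := by
    intro σ r; funext n; cases n <;> rfl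
  induction A generalizing σ κ r c with
  | var x => rfl
  | lam M ih => simp only [rename, ctxInst, ih, up_comp']
  | app M N ihM ihN => simp only [rename, ctxInst, ihM, ihN]
  | letin L M ihL ihM => simp only [rename, ctxInst, ihL, ihM, up_comp']
  | mu J ih =>
    simp only [rename, ctxInst, ih]
    congr 2
    funext n; cases n <;> rfl
  | jmp k M ih => simp only [rename, ctxInst, ih]

theorem rename_ctxInst {s : Cat} (A : Expr s) (σ : ℕ → Expr Cat.term) (κ : ℕ → Ctx)
    (r c : ℕ → ℕ) : rename r c (ctxInst σ κ A) =
      ctxInst (fun n => rename r c (σ n)) (fun n => (κ n).rename r c) A := by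
  have up_comm : ∀ (σ : ℕ → Expr Cat.term) (r c : ℕ → ℕ),
      (fun n => rename (up r) c (upSubst σ n)) = upSubst fun n => rename r c (σ n) := by
    intro σ r c; funext n; cases n
    exacts [rfl, rename_wkVar _ _ _]
  induction A generalizing σ κ r c with
  | var x => rfl
  | lam M ih => simp only [rename, ctxInst, ih, up_comm, Ctx.rename_rename]; rfl
  | app M N ihM ihN => simp only [rename, ctxInst, ihM, ihN]
  | letin L M ihL ihM =>
    simp only [rename, ctxInst, ihL, ihM, up_comm, Ctx.rename_rename]; rfl
  | mu J ih =>
    simp only [rename, ctxInst, ih, rename_wkCont]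
    congr 2
    funext n
    cases n
    · rfl
    · simp only [cons_succ, Ctx.rename_rename]; rfl
  | jmp k M ih => simp only [ctxInst, Ctx.rename_fill, ih]

@[simp] theorem ctxInst_id {s : Cat} (A : Expr s) : ctxInst var Ctx.jump A = A :=
  (rename_eq_ctxInst A id id).symm.trans (rename_id A)

theorem freeCont_ctxInst {s : Cat} (A : Expr s) {k k' : ℕ} {σ : ℕ → Expr Cat.term}
    {κ : ℕ → Ctx} (hσ : ∀ n, ¬ FreeCont k' (σ n)) (hκ : ∀ j, (κ j).FreeCont k' ↔ j = k) :
    FreeCont k' (ctxInst σ κ A) ↔ FreeCont k A := by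
  have up_free : ∀ {k : ℕ} {σ : ℕ → Expr Cat.term}, (∀ n, ¬ FreeCont k (σ n)) →
      ∀ n, ¬ FreeCont k (upSubst σ n) := by
    rintro k σ h (_ | n)
    exacts [fun h => h, (freeCont_wkVar _ _).not.2 (h n)]
  have ctx_free : ∀ {k k' : ℕ} {κ : ℕ → Ctx}, (∀ j, (κ j).FreeCont k' ↔ j = k) →
      ∀ j, ((κ j).rename Nat.succ id).FreeCont k' ↔ j = k := by
    intro k k' κ h j
    simp [Ctx.freeCont_rename, h]
  induction A generalizing k k' σ κ with
  | var x => exact iff_of_false (hσ x) id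
  | lam M ih => exact ih (up_free hσ) (ctx_free hκ)
  | app M N ihM ihN => exact or_congr (ihM hσ hκ) (ihN hσ hκ)
  | letin L M ihL ihM => exact or_congr (ihL (up_free hσ) (ctx_free hκ)) (ihM hσ hκ)
  | mu J ih =>
    refine ih (fun n => (freeCont_wkCont_succ _ _).not.2 (hσ n)) ?_
    rintro (_ | j)
    · simp [Ctx.FreeCont]
    · simp [Ctx.freeCont_rename, hκ]
  | jmp j M ih =>
    exact (Ctx.freeCont_fill _ _ _).trans (or_congr (hκ j) (ih hσ hκ))

/-! ### Normal form `[k]M` of a jump -/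

/-- The continuation variable `k` of a jump, written as `[k]M`. -/
def tail : {s : Cat} → Expr s → ℕ
  | Cat.jump, jmp k _ => k
  | Cat.jump, letin J _ => tail J
  | Cat.term, _ => 0

/-- The term `M` of a jump, written as `[k]M`. -/
def body : {s : Cat} → Expr s → Expr Cat.term
  | Cat.jump, jmp _ M => M
  | Cat.jump, letin J M => letin (body J) M
  | Cat.term, M => M

/-- Jumps are only one index of the family `Expr`, so the motive is extended to all categories by
`True` on terms. -/
theorem jump_induction {p : Expr Cat.jump → Prop} (h₁ : ∀ k M, p (jmp k M))
    (h₂ : ∀ J M, p J → p (letin J M)) (J : Expr Cat.jump) : p J := by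
  have h : ∀ {s : Cat} (A : Expr s), match s, A with
      | Cat.jump, J => p J
      | Cat.term, _ => True := by
    intro s A
    induction A with
    | @letin s L M ihL _ =>
      cases s
      exacts [trivial, h₂ L M ihL]
    | jmp k M => exact h₁ k M
    | _ => trivial
  exact h J

theorem ident_jmp_tail_body (J : Expr Cat.jump) : Ident J (jmp (tail J) (body J)) := by
  induction J using jump_induction with
  | h₁ k M => exact .refl _
  | h₂ J M ih => exact (ih.letin (.refl M)).trans (.symm (.axm (.jmp_let _ _ _)))

/-- The form `[k]M` of a jump is unique up to the equality axioms: the axiom `jmp_let` changes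
neither tail nor body, and the other two concern terms, where `body` is the identity. -/
theorem Ident.tail_body {s : Cat} {A B : Expr s} (h : Ident A B) :
    tail A = tail B ∧ Ident (body A) (body B) := by
  induction h with
  | axm h =>
    cases h with
    | assoc L M N => exact ⟨rfl, .axm (.assoc L M N)⟩
    | mu_let J M => exact ⟨rfl, .axm (.mu_let J M)⟩
    | jmp_let k L M => exact ⟨rfl, .refl _⟩
  | refl => exact ⟨rfl, .refl _⟩
  | symm _ ih => exact ⟨ih.1.symm, ih.2.symm⟩
  | trans _ _ ih ih' => exact ⟨ih.1.trans ih'.1, ih.2.trans ih'.2⟩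
  | lam h _ => exact ⟨rfl, h.lam⟩
  | app h h' _ _ => exact ⟨rfl, h.app h'⟩
  | @letin s _ _ _ _ h h' ih _ =>
    cases s
    · exact ⟨rfl, h.letin h'⟩
    · exact ⟨ih.1, ih.2.letin h'⟩
  | mu h _ => exact ⟨rfl, h.mu⟩
  | jmp k h _ => exact ⟨rfl, h⟩

theorem tail_rename (J : Expr Cat.jump) (ρ κ : ℕ → ℕ) : tail (rename ρ κ J) = κ (tail J) := by
  induction J using jump_induction generalizing ρ with
  | h₁ k M => rfl
  | h₂ J M ih => exact ih _

/-- The term `M` is arbitrary, since the tail of a filled context does not see what fills the hole.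
-/
theorem tail_ctxInst (J : Expr Cat.jump) (σ : ℕ → Expr Cat.term) {κ : ℕ → Ctx} {M} :
    tail (ctxInst σ κ J) = tail ((κ (tail J)).fill M) := by
  induction J using jump_induction generalizing σ κ M with
  | h₁ k N => simp only [ctxInst, tail]; cases κ k <;> rfl
  | h₂ J N ih =>
    simp only [ctxInst, tail]
    rw [ih (M := M)]
    cases κ (tail J)
    · rfl
    · simp [Ctx.rename, Ctx.fill, tail, tail_rename]

theorem body_ctxInst (J : Expr Cat.jump) (σ : ℕ → Expr Cat.term) {κ : ℕ → Ctx} {l : ℕ}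
    (h : κ (tail J) = Ctx.jump l) : body (ctxInst σ κ J) = ctxInst σ κ (body J) := by
  induction J using jump_induction generalizing σ κ with
  | h₁ k N =>
    simp only [tail] at h
    simp only [ctxInst, h, Ctx.fill, body]
  | h₂ J N ih =>
    simp only [tail] at h
    simp only [ctxInst, body]
    rw [ih (κ := fun n => (κ n).rename Nat.succ id) _ (by simp only [h, Ctx.rename, id])]

/-- The axiom `assoc` is stated for terms only; for a jump it follows by writing `J` as `[k]L` and
moving `[k]` inwards and outwards again. -/
theorem ident_letin_letin (J : Expr Cat.jump) (M N : Expr Cat.term) :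
    Ident (letin J (letin M N)) (letin (letin (wkVarUnder J) M) N) := by
  have h := ident_jmp_tail_body J
  refine (h.letin (.refl _)).trans ((Ident.symm (.axm (.jmp_let _ _ _))).trans ?_)
  refine (Ident.jmp _ (.axm (.assoc _ _ _))).trans ((Ident.axm (.jmp_let _ _ _)).trans ?_)
  refine Ident.letin ((Ident.axm (.jmp_let _ _ _)).trans (.letin ?_ (.refl _))) (.refl _)
  exact (h.rename (up Nat.succ) id).symm

theorem ident_fill_letin (C : Ctx) (M N : Expr Cat.term) :
    Ident (C.fill (letin M N)) (letin ((C.rename Nat.succ id).fill M) N) := by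
  cases C with
  | jump k => exact .axm (.jmp_let _ _ _)
  | bind J => exact ident_letin_letin J M N

theorem ident_ctxInst_fill (J : Expr Cat.jump) (σ : ℕ → Expr Cat.term) (κ : ℕ → Ctx) :
    Ident (ctxInst σ κ J) ((κ (tail J)).fill (ctxInst σ κ (body J))) := by
  induction J using jump_induction generalizing σ κ with
  | h₁ k N => exact .refl _
  | h₂ J N ih =>
    exact ((ih (upSubst σ) fun n => (κ n).rename Nat.succ id).letin (.refl _)).trans
      (ident_fill_letin _ _ _).symm

/-- Since `[k](L⟨x := Q⟩) = ([k]L)⟨x := Q⟩`, the recursive replacement in `beta_mu` is the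
substitution of the context `([k]L)⟨x := □⟩` for `k`. The renaming `f` accounts for a later
contraction by `beta_jmp`. -/
theorem ident_rename_ctxSubst {s : Cat} (A : Expr s) (k : ℕ) (L : Expr Cat.term) (f : ℕ → ℕ)
    {κ : ℕ → Ctx} {J : Expr Cat.jump} (hk : κ k = Ctx.bind J)
    (hJ : Ident (jmp (f k) (rename id f L)) J) (hκ : ∀ j, j ≠ k → κ j = Ctx.jump (f j)) :
    Ident (rename id f (ctxSubst k L A)) (ctxInst var κ A) := by
  have up_var : upSubst var = var := by funext n; cases n <;> rfl
  have under : ∀ (k : ℕ) (L : Expr Cat.term) (f : ℕ → ℕ) {J : Expr Cat.jump},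
      Ident (jmp (f k) (rename id f L)) J →
        Ident (jmp (f k) (rename id f (wkVarUnder L))) (rename (up Nat.succ) id J) := by
    intro k L f J h
    convert h.rename (up Nat.succ) id using 1
    simp only [rename, wkVarUnder, rename_rename]
    rfl
  induction A generalizing k L f κ J with
  | var x => exact .refl _
  | lam M ih =>
    simp only [rename, ctxSubst, ctxInst, up_var, up_id]
    exact (ih k _ f (by rw [hk]; rfl) (under k L f hJ) fun j hj => by rw [hκ j hj]; rfl).lam
  | app M N ihM ihN => exact (ihM k L f hk hJ hκ).app (ihN k L f hk hJ hκ)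
  | letin B M ihB ihM =>
    simp only [rename, ctxSubst, ctxInst, up_var, up_id]
    exact (ihB k _ f (by rw [hk]; rfl) (under k L f hJ) fun j hj => by rw [hκ j hj]; rfl).letin
      (ihM k L f hk hJ hκ)
  | mu J' ih =>
    refine (ih (k + 1) (wkCont L) (up f) (J := wkCont J) ?_ ?_ ?_).mu
    · simp only [cons_succ, hk, Ctx.rename, up_id]; rfl
    · have h := hJ.rename id Nat.succ
      convert h using 1
      · simp only [rename, wkCont, rename_rename]
        rfl
      · rfl
    · rintro (_ | j) hj
      · rfl
      · simp only [cons_succ, hκ j (by simpa using hj)]; rfl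
  | jmp j M ih =>
    have h := ih k L f hk hJ hκ
    rw [ctxSubst]
    split_ifs with hj
    · subst hj
      simp only [rename, ctxInst, hk, Ctx.fill, up_id]
      exact (Ident.axm (.jmp_let _ _ _)).trans (hJ.letin h)
    · simp only [rename, ctxInst, hκ j hj, Ctx.fill]
      exact h.jmp _

/-! ### Eta-contracted μ-abstraction -/

open Classical in
/-- The term `μk. J`, contracted if it is an `η`-redex up to the equality axioms. -/
noncomputable def muEta (J : Expr Cat.jump) : Expr Cat.term :=
  if tail J = 0 ∧ ¬ FreeCont 0 (body J) then lowerCont (body J) else mu J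

theorem muEta_pos {J : Expr Cat.jump} (h : tail J = 0) (h' : ¬ FreeCont 0 (body J)) :
    muEta J = lowerCont (body J) := if_pos ⟨h, h'⟩

theorem muEta_neg {J : Expr Cat.jump} (h : ¬ (tail J = 0 ∧ ¬ FreeCont 0 (body J))) :
    muEta J = mu J := if_neg h

@[simp] theorem muEta_jmp_wkCont (M : Expr Cat.term) : muEta (jmp 0 (wkCont M)) = M :=
  (muEta_pos (J := jmp 0 (wkCont M)) rfl (freeCont_wkCont_zero M)).trans (lowerCont_wkCont M)

/-- The bound variable is sent to itself and is fresh for everything substituted, so the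
substitution neither creates nor destroys the η-redex at the root. -/
theorem ctxInst_muEta (J : Expr Cat.jump) (σ : ℕ → Expr Cat.term) (κ : ℕ → Ctx) :
    ctxInst σ κ (muEta J) = muEta (ctxInst (fun n => wkCont (σ n))
      (cons (Ctx.jump 0) fun n => (κ n).rename id Nat.succ) J) := by
  set κ' : ℕ → Ctx := cons (Ctx.jump 0) fun n => (κ n).rename id Nat.succ with hκ'
  have hfree : ∀ j, (κ' j).FreeCont 0 ↔ j = 0 := by
    rintro (_ | j)
    · simp [hκ', Ctx.FreeCont]
    · simp [hκ', Ctx.freeCont_rename]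
  have htail : tail (ctxInst (fun n => wkCont (σ n)) κ' J) = 0 ↔ tail J = 0 := by
    rw [tail_ctxInst (M := var 0)]
    rcases tail J with _ | n
    · exact iff_of_true rfl rfl
    · simp only [hκ', cons_succ]
      cases κ n <;> simp [Ctx.rename, Ctx.fill, tail, tail_rename]
  by_cases h : tail J = 0 ∧ ¬ FreeCont 0 (body J)
  · have hb := body_ctxInst J (fun n => wkCont (σ n)) (κ := κ') (l := 0) (by rw [h.1]; rfl)
    rw [muEta_pos h.1 h.2, muEta_pos (htail.2 h.1), hb]
    · conv_rhs => rw [← wkCont_lowerCont h.2]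
      rw [wkCont, ctxInst_rename]
      conv_lhs => rw [← lowerCont_wkCont (ctxInst σ κ (lowerCont (body J)))]
      rw [wkCont, rename_ctxInst]
      rfl
    · rw [hb, freeCont_ctxInst _ (fun n => freeCont_wkCont_zero _) hfree]
      exact h.2
  · rw [muEta_neg h, muEta_neg]
    · rfl
    · rw [htail]
      rintro ⟨h₁, h₂⟩
      rw [body_ctxInst J _ (l := 0) (by rw [h₁]; rfl),
        freeCont_ctxInst _ (fun n => freeCont_wkCont_zero _) hfree] at h₂
      exact h ⟨h₁, h₂⟩

theorem rename_muEta (J : Expr Cat.jump) (ρ κ : ℕ → ℕ) :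
    rename ρ κ (muEta J) = muEta (rename ρ (up κ) J) := by
  simp only [rename_eq_ctxInst, ctxInst_muEta]
  congr 2
  funext n; cases n <;> rfl

theorem reds_mu_muEta (J : Expr Cat.jump) : Reds (mu J) (muEta J) := by
  by_cases h : tail J = 0 ∧ ¬ FreeCont 0 (body J)
  · rw [muEta_pos h.1 h.2]
    have hJ := ident_jmp_tail_body J
    rw [h.1, ← wkCont_lowerCont h.2] at hJ
    exact (Reds.of_ident hJ.mu).trans (.of_rule (.eta_mu _))
  · rw [muEta_neg h]; exact .refl _

end Expr

/-! ### Simulation of steps between jumps -/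

namespace Expr

/-- A step from the jump `J` to the jump `J'` which is visible in the body of `J`: either the body
is reduced, or it is reduced to a `μ`-abstraction which is applied to the tail of `J`. -/
def Simulates (J J' : Expr Cat.jump) : Prop :=
  (tail J' = tail J ∧ Reds (body J) (body J')) ∨
    ∃ J₁, Reds (body J) (mu J₁) ∧ Reds (instCont J₁ (tail J)) J'

namespace Simulates

theorem of_ident {J J' : Expr Cat.jump} (h : Ident J J') : Simulates J J' :=
  .inl ⟨h.tail_body.1.symm, .of_ident h.tail_body.2⟩

theorem head {J J' J'' : Expr Cat.jump} (ht : tail J' = tail J) (hb : Reds (body J) (body J'))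
    (h : Simulates J' J'') : Simulates J J'' := by
  rcases h with ⟨h₁, h₂⟩ | ⟨J₁, h₁, h₂⟩
  · exact .inl ⟨h₁.trans ht, hb.trans h₂⟩
  · exact .inr ⟨J₁, hb.trans h₁, ht ▸ h₂⟩

theorem reds {J J' : Expr Cat.jump} (h : Simulates J J') : Reds J J' := by
  refine (Reds.of_ident (ident_jmp_tail_body J)).trans ?_
  rcases h with ⟨h₁, h₂⟩ | ⟨J₁, h₁, h₂⟩
  · rw [← h₁]
    exact (h₂.jmp _).trans (.of_ident (ident_jmp_tail_body J').symm)
  · exact (h₁.jmp _).trans ((Reds.of_rule (.beta_jmp _ _)).trans h₂)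

theorem letin {J J' : Expr Cat.jump} (h : Simulates J J') (M : Expr Cat.term) :
    Simulates (letin J M) (letin J' M) := by
  rcases h with ⟨h₁, h₂⟩ | ⟨J₁, h₁, h₂⟩
  · exact .inl ⟨h₁, h₂.letin (.refl M)⟩
  -- The let is pushed under the `μ` by the axiom `mu_let`.
  · refine .inr ⟨Expr.letin J₁ (wkCont M), (h₁.letin (.refl M)).trans
      (.of_ident (.axm (.mu_let _ _))), ?_⟩
    refine .trans (.of_eq ?_) (h₂.letin (.refl M))
    simp only [instCont, wkCont, rename, rename_rename, up_id, tail]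
    congr 1
    exact rename_id M

/-- If `muEta` has erased `[k]` from `[k]M`, a reduction of `M` can still be performed, and a
contraction of `[k]μl.J₁` need not be: the term `μl.J₁` is already the abstraction of the result, up
to renaming `l`. -/
theorem muEta {J J' : Expr Cat.jump} (h : Simulates J J') : Reds (muEta J) (muEta J') := by
  by_cases hJ : tail J = 0 ∧ ¬ FreeCont 0 (body J)
  · rw [muEta_pos hJ.1 hJ.2]
    rcases h with ⟨h₁, h₂⟩ | ⟨J₁, h₁, h₂⟩
    · rw [muEta_pos (h₁.trans hJ.1) fun h => hJ.2 (h₂.freeCont h)]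
      exact h₂.rename _ _
    · refine (h₁.rename id Nat.pred).trans (.trans (.mu (.trans (.of_eq ?_) h₂))
        (reds_mu_muEta J'))
      rw [hJ.1]
      -- Lowering under the `μ` and redirecting the bound index to `0` differ at index `1` only,
      -- which is the variable of the erased jump and is not free in `J₁`.
      refine rename_congr J₁ id ?_
      rintro (_ | _ | k) hk
      · rfl
      · exact absurd (h₁.freeCont (k := 0) hk) hJ.2
      · rfl
  · rw [muEta_neg hJ]
    exact h.reds.mu.trans (reds_mu_muEta J')

end Simulates

theorem tail_fill (C : Ctx) (M N : Expr Cat.term) : tail (C.fill M) = tail (C.fill N) := by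
  cases C <;> rfl

theorem reds_body_fill (C : Ctx) {M N : Expr Cat.term} (h : Reds M N) :
    Reds (body (C.fill M)) (body (C.fill N)) := by
  cases C with
  | jump k => exact h
  | bind J => exact Reds.letin (.refl _) h

theorem simulates_fill (C : Ctx) {M N : Expr Cat.term} (h : Reds M N) :
    Simulates (C.fill M) (C.fill N) :=
  .inl ⟨tail_fill _ _ _, reds_body_fill C h⟩

/-- An η-redex `[k]M` needs no reduction: filling `C` with `M` is the substitution of `C` for `k`,
up to the axioms. Otherwise `beta_jmp` serves for `C = [l]□`. For a let-context `beta_mu` makes the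
body a `μ`, and `beta_jmp` applies it to the tail. -/
theorem simulates_fill_muEta (C : Ctx) (J : Expr Cat.jump) :
    Simulates (C.fill (muEta J)) (ctxInst var (cons C Ctx.jump) J) := by
  by_cases h : tail J = 0 ∧ ¬ FreeCont 0 (body J)
  · rw [muEta_pos h.1 h.2]
    refine .of_ident (.symm ?_)
    have h' := ident_ctxInst_fill J var (cons C Ctx.jump)
    rw [h.1, cons_zero] at h'
    convert h'
    conv_rhs => rw [← wkCont_lowerCont h.2]
    rw [wkCont, ctxInst_rename]
    exact (ctxInst_id _).symm
  · rw [muEta_neg h]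
    cases C with
    | jump k =>
      refine .inr ⟨J, .refl _, .of_eq ?_⟩
      rw [instCont, rename_eq_ctxInst]
      congr 1
      funext n; cases n <;> rfl
    | bind J₀ =>
      refine .inr ⟨_, .of_rule (.beta_mu _ _), .of_ident ?_⟩
      refine ident_rename_ctxSubst J 0 (wkCont (body J₀)) _ rfl ?_ ?_
      · rw [wkCont, rename_rename]
        refine .trans (.jmp _ ?_) (ident_jmp_tail_body J₀).symm
        exact Eq.mpr (congrArg (Ident · _) (rename_id (body J₀))) (.refl _)
      · rintro (_ | j) hj
        exacts [absurd rfl hj, rfl]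

theorem reds_letin_muEta (J : Expr Cat.jump) (M : Expr Cat.term) :
    Reds (letin (muEta J) M) (muEta (letin J (wkCont M))) := by
  by_cases h : tail J = 0 ∧ ¬ FreeCont 0 (body J)
  · rw [muEta_pos h.1 h.2, muEta_pos (J := letin J (wkCont M)) h.1]
    · simp only [body, lowerCont, rename, up_id]
      exact Reds.letin (.refl _) (.of_eq (lowerCont_wkCont M).symm)
    · simpa [body, FreeCont] using h.2
  · rw [muEta_neg h]
    exact (Reds.of_ident (.axm (.mu_let _ _))).trans (reds_mu_muEta _)

/-- Turn a jump into an expression of a given category, by abstracting the continuation variable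
`0` in the case of terms. -/
noncomputable def close : (s : Cat) → Expr Cat.jump → Expr s
  | Cat.term, J => muEta J
  | Cat.jump, J => J

/-- This is the source counterpart of plugging the continuation `kont` into a command. -/
theorem reds_letin_close {s : Cat} (J₁ J₂ : Expr Cat.jump) :
    Reds (letin (close s J₁) (muEta J₂))
      (close s (ctxInst var (cons (Ctx.bind J₁) fun n => Ctx.jump (s.shift n)) J₂)) := by
  cases s with
  | jump => exact (simulates_fill_muEta (Ctx.bind J₁) J₂).reds
  | term =>
    refine (reds_letin_muEta J₁ (muEta J₂)).trans ?_
    -- The let has moved under the abstraction of `J₁`, so the free continuation variables of `muEta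
    -- J₂` are shifted; the variable bound in `J₂` stays at `0`.
    have h := (simulates_fill_muEta (Ctx.bind J₁) (rename id (up Nat.succ) J₂)).muEta
    rw [← rename_muEta, ctxInst_rename] at h
    refine .trans h (.of_eq ?_)
    simp only [close]
    congr 2
    funext n; cases n <;> rfl

end Expr

/-! ### The inverse translation -/

namespace Cps

open CCV.Expr (muEta)

/-- The syntactic objects that correspond to the sorts of the target calculus. -/
abbrev Readback : CpsSort → Type
  | CpsSort.val => Expr Cat.term
  | CpsSort.cont => Ctx
  | CpsSort.cmd => Expr Cat.jump

/-- The inverse CPS translation. -/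
noncomputable def readback : {s : CpsSort} → Cps s → Readback s
  | _, var x => Expr.var x
  | _, lam Q => Expr.lam (muEta (readback Q))
  | _, cvar k => Ctx.jump k
  | _, kont Q => Ctx.bind (readback Q)
  | _, ret K W => (readback K).fill (readback W)
  | _, call V W K => (readback K).fill (Expr.app (readback V) (readback W))

/-- Renaming of the objects of the inverse translation. -/
def renameReadback (ρ κ : ℕ → ℕ) : {s : CpsSort} → Readback s → Readback s
  | CpsSort.val, M => Expr.rename ρ κ M
  | CpsSort.cont, C => Ctx.rename ρ κ C
  | CpsSort.cmd, J => Expr.rename ρ κ J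

theorem readback_rename {s : CpsSort} (A : Cps s) (r c : ℕ → ℕ) :
    readback (rename r c A) = renameReadback r c (readback A) := by
  induction A generalizing r c with
  | var x => rfl
  | lam Q ih =>
    simp only [rename, readback, renameReadback, ih, Expr.rename, Expr.rename_muEta]
  | cvar k => rfl
  | kont Q ih => simp only [rename, readback, renameReadback, ih, Ctx.rename]
  | ret K W ihK ihW => simp only [rename, readback, renameReadback, ihK, ihW, Ctx.rename_fill]
  | call V W K ihV ihW ihK =>
    simp only [rename, readback, renameReadback, ihV, ihK, ihW, Ctx.rename_fill, Expr.rename]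

/-- Substitution in the objects of the inverse translation. -/
def substReadback (σ : ℕ → Expr Cat.term) (κ : ℕ → Ctx) : {s : CpsSort} → Readback s → Readback s
  | CpsSort.val, M => Expr.ctxInst σ κ M
  | CpsSort.cont, Ctx.jump k => κ k
  | CpsSort.cont, Ctx.bind J =>
      Ctx.bind (Expr.ctxInst (Expr.upSubst σ) (fun n => (κ n).rename Nat.succ id) J)
  | CpsSort.cmd, J => Expr.ctxInst σ κ J

theorem ctxInst_fill (C : Ctx) (M : Expr Cat.term) (σ : ℕ → Expr Cat.term) (κ : ℕ → Ctx) :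
    Expr.ctxInst σ κ (C.fill M) =
      Ctx.fill (substReadback (s := CpsSort.cont) σ κ C) (Expr.ctxInst σ κ M) := by
  cases C <;> rfl

theorem readback_subst {s : CpsSort} (A : Cps s) (σ : ℕ → Cps CpsSort.val)
    (κ : ℕ → Cps CpsSort.cont) : readback (subst σ κ A) =
      substReadback (fun n => readback (σ n)) (fun n => readback (κ n)) (readback A) := by
  induction A generalizing σ κ with
  | var x => rfl
  | lam Q ih =>
    simp only [subst, readback, substReadback, ih, Expr.ctxInst, Expr.ctxInst_muEta]
    congr 3 <;> funext n <;> cases n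
    · rfl
    · simp only [cons_succ, readback_rename, renameReadback, Expr.upSubst, Expr.wkVar,
        Expr.wkCont, Expr.rename_rename]
      rfl
    · rfl
    · simp only [cons_succ, readback_rename, renameReadback, Ctx.rename_rename]
      rfl
  | cvar k => rfl
  | kont Q ih =>
    simp only [subst, readback, substReadback, ih]
    congr 2 <;> funext n
    · cases n
      · rfl
      · simp only [cons_succ, readback_rename, renameReadback, Expr.upSubst, Expr.wkVar]
    · simp only [readback_rename, renameReadback]
  | ret K W ihK ihW =>
    simp only [subst, readback, ihK, ihW]
    exact (ctxInst_fill _ _ _ _).symm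
  | call V W K ihV ihW ihK =>
    simp only [subst, readback, ihV, ihK, ihW]
    exact (ctxInst_fill (readback K) (Expr.app (readback V) (readback W)) _ _).symm

theorem isValue_readback (W : Cps CpsSort.val) : Expr.IsValue (readback W) := by
  cases W
  exacts [.var _, .lam _]

/-- The relation between the inverse translations of the two sides of a reduction step. -/
def ReadbackRel : {s : CpsSort} → Readback s → Readback s → Prop
  | CpsSort.val, M, M' => Expr.Reds M M'
  | CpsSort.cont, C, C' => ∀ M, Expr.Simulates (C.fill M) (C'.fill M)
  | CpsSort.cmd, J, J' => Expr.Simulates J J'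

theorem readback_subst_single (Q : Cps CpsSort.cmd) (W : Cps CpsSort.val) :
    readback (subst (cons W var) cvar Q) = Expr.inst (readback Q) (readback W) := by
  rw [readback_subst, Expr.inst, Expr.subst_eq_ctxInst]
  simp only [substReadback]
  congr 1
  funext n; cases n <;> rfl

theorem simulates_inst (J : Expr Cat.jump) {V : Expr Cat.term} (hV : Expr.IsValue V) :
    Expr.Simulates (Expr.letin J V) (Expr.inst J V) := by
  have h : Expr.tail (Expr.inst J V) = Expr.tail J := by
    rw [Expr.inst, Expr.subst_eq_ctxInst, Expr.tail_ctxInst (M := V)]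
    rfl
  refine .inl ⟨h, (Expr.Reds.of_rule (.beta_let _ _ hV)).trans (.of_eq ?_)⟩
  simp only [Expr.inst, Expr.subst_eq_ctxInst]
  exact (Expr.body_ctxInst J _ rfl).symm

/-- The β-rules are simulated by `beta_let`, and by `beta_lam` and `beta_let` followed by
`simulates_fill_muEta`; the η-rules for continuations and values become `eta_let` and `eta_lam`. -/
theorem Step.readback {s : CpsSort} {A B : Cps s} (h : Step A B) :
    ReadbackRel (readback A) (readback B) := by
  induction h with
  | beta_ret Q W =>
    rw [readback_subst_single]
    exact simulates_inst _ (isValue_readback W)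
  | beta_call Q W K =>
    set V := Cps.readback W
    set C := Cps.readback K
    set J := Cps.readback Q
    have h : Expr.Reds (Expr.app (Expr.lam (muEta J)) V) (muEta (Expr.ctxInst
        (fun n => Expr.wkCont (Expr.single V n)) Ctx.jump J)) := by
      have hV : Expr.IsValue V := isValue_readback W
      refine (Expr.Reds.of_rule (.beta_lam _ _ hV)).trans
        ((Expr.Reds.of_rule (.beta_let _ _ hV)).trans (.of_eq ?_))
      rw [Expr.inst, Expr.subst_eq_ctxInst, Expr.ctxInst_muEta]
      congr 2
      funext n; cases n <;> rfl
    have h' := (Expr.simulates_fill_muEta C (Expr.ctxInst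
        (fun n => Expr.wkCont (Expr.single V n)) Ctx.jump J))
    have e : Cps.readback (Cps.subst (cons W var) (cons K cvar) Q) = Expr.ctxInst Expr.var
        (cons C Ctx.jump) (Expr.ctxInst (fun n => Expr.wkCont (Expr.single V n)) Ctx.jump J) := by
      -- The target replaces argument and continuation at once, the source one after the other, so
      -- the value must be weakened past the continuation variable.
      have e₁ : Cps.subst (cons W var) (cons K cvar) Q = Cps.subst var (cons K cvar)
          (Cps.subst (cons (rename id Nat.succ W) var) cvar Q) := by
        rw [subst_subst]
        refine subst_congr _ ?_ ?_ <;> rintro (_ | n) <;> try rfl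
        simp only [cons_zero, subst_rename]
        exact (subst_id W).symm
      rw [e₁, readback_subst, readback_subst]
      simp only [substReadback]
      congr 1
      · funext n; cases n <;> rfl
      · congr 1
        funext n
        cases n
        · exact readback_rename _ _ _
        · rfl
    change Expr.Simulates _ (Cps.readback (Cps.subst (cons W var) (cons K cvar) Q))
    rw [e]
    exact .head (Expr.tail_fill _ _ _) (Expr.reds_body_fill C h) h'
  | eta_cont k =>
    intro M
    exact .inl ⟨rfl, .of_rule (.eta_let M)⟩
  | eta_val x =>
    have h := Expr.Rule.eta_lam (Expr.var x) (.var x)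
    refine .trans (.of_eq ?_) (Expr.Reds.of_rule h)
    exact congrArg Expr.lam
      (Expr.muEta_jmp_wkCont (Expr.app (Expr.wkVar (Expr.var x)) (Expr.var 0)))
  | lam _ ih => exact Expr.Reds.lam (Expr.Simulates.muEta ih)
  | kont _ ih => exact fun M => Expr.Simulates.letin ih M
  | ret_left W _ ih => exact ih _
  | ret_right K _ ih => exact Expr.simulates_fill _ ih
  | call_fun W K _ ih => exact Expr.simulates_fill _ (Expr.Reds.app ih (.refl _))
  | call_arg V K _ ih => exact Expr.simulates_fill _ (Expr.Reds.app (.refl _) ih)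
  | call_cont V W _ ih => exact ih _

theorem Steps.reds_close {Q Q' : Cps CpsSort.cmd} (h : Steps Q Q') (s : Cat) :
    Expr.Reds (Expr.close s (Cps.readback Q)) (Expr.close s (Cps.readback Q')) := by
  induction h with
  | refl => exact .refl _
  | tail _ h ih =>
    refine ih.trans ?_
    have h' : Expr.Simulates _ _ := h.readback
    cases s
    exacts [h'.muEta, h'.reds]

end Cps

/-! ### Every expression reduces to the readback of its translation -/

namespace Expr

open Cps (readback plug appArg appCps)

theorem readback_plug (s : Cat) (Q : Cps CpsSort.cmd) (K : Cps CpsSort.cont) :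
    readback (plug s Q K) =
      ctxInst var (cons (readback K) fun n => Ctx.jump (s.shift n)) (readback Q) := by
  rw [plug, Cps.readback_subst]
  simp only [Cps.substReadback]
  congr 1
  funext n; cases n <;> rfl

theorem readback_wkCont (W : Cps CpsSort.val) :
    readback (Cps.rename id Nat.succ W) = wkCont (readback W) :=
  Cps.readback_rename W id Nat.succ

theorem reds_app_appArg (V : Cps CpsSort.val) (N : Expr Cat.term) {Q : Cps CpsSort.cmd}
    {W : Cps CpsSort.val} (hN : Reds N (muEta (readback Q)))
    (hQ : isVal N = true → Q = Cps.ret (Cps.cvar 0) (Cps.rename id Nat.succ W)) :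
    Reds (app (readback V) N) (muEta (readback (appArg V (isVal N) Q W))) := by
  cases h : isVal N
  · refine (Reds.of_rule (.ad₂ _ _ (Cps.isValue_readback V) ?_)).trans ?_
    · rw [← isVal_iff, h]; exact Bool.false_ne_true
    · have h' := reds_letin_close (s := Cat.term) (readback
        (Cps.call (Cps.rename Nat.succ Nat.succ V) (Cps.var 0) (Cps.cvar 0))) (readback Q)
      simp only [appArg, Bool.false_eq_true, if_false, readback_plug]
      refine (Reds.letin (.of_eq ?_) hN).trans h'
      refine (muEta_jmp_wkCont _).symm.trans ?_
      simp only [close, readback, Cps.readback_rename, Cps.renameReadback, wkCont, wkVar, rename,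
        rename_rename]
      rfl
  · rw [hQ h] at hN
    simp only [readback, readback_wkCont, Ctx.fill, muEta_jmp_wkCont] at hN
    simp only [appArg, if_true, readback, readback_wkCont, Ctx.fill]
    exact (Reds.app (.refl _) hN).trans (.of_eq (muEta_jmp_wkCont (app _ _)).symm)

/-- Translating back names non-value parts of applications, by `ad₁` and `ad₂`, and carries out the
substitutions made by plugging, by `reds_letin_close` and `simulates_fill_muEta`. The root
contraction in `muEta` is essential for values: the translation of `x` reads back as `[k]x`, and
closing it must give `x`, not `μk.[k]x`. -/
theorem reds_close_cps {s : Cat} (A : Expr s) : Reds A (close s (readback (cps A))) := by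
  induction A with
  | var x => exact .of_eq (muEta_jmp_wkCont (var x)).symm
  | lam M ih =>
    rw [cps_lam]
    simp only [readback, readback_wkCont, Ctx.fill, close, muEta_jmp_wkCont]
    exact ih.lam
  | app M N ihM ihN =>
    rw [cps_app]
    simp only [close] at ihM ihN ⊢
    cases h : isVal M
    · refine (Reds.of_rule (.ad₁ _ _ ?_)).trans ?_
      · rw [← isVal_iff, h]; exact Bool.false_ne_true
      · have hN := ihN.rename Nat.succ id
        rw [rename_muEta, up_id] at hN
        have h₁ := reds_app_appArg (Cps.var 0) (wkVar N)
          (Q := Cps.rename Nat.succ id (cps N)) (W := Cps.rename Nat.succ id (cpsVal N))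
          (hN.trans (.of_eq (by rw [Cps.readback_rename]; rfl))) ?_
        · have h₂ := reds_letin_close (s := Cat.term) (readback (appArg (Cps.var 0)
            (isVal (wkVar N)) (Cps.rename Nat.succ id (cps N))
            (Cps.rename Nat.succ id (cpsVal N)))) (readback (cps M))
          rw [wkVar, isVal_rename] at h₁ h₂
          simp only [appCps, Bool.false_eq_true, if_false, readback_plug]
          exact (Reds.letin h₁ ihM).trans h₂
        · rw [wkVar, isVal_rename]
          intro hN
          rw [cps_of_isVal hN]
          simp only [Cps.rename, Cps.rename_rename]
          rfl
    · have hM : Reds M (readback (cpsVal M)) := by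
        rw [cps_of_isVal h] at ihM
        simpa only [readback, readback_wkCont, Ctx.fill, muEta_jmp_wkCont] using ihM
      simp only [appCps, if_true]
      exact (hM.app (.refl N)).trans (reds_app_appArg _ N ihN cps_of_isVal)
  | letin L M ihL ihM =>
    rw [cps_letin, readback_plug]
    exact (ihL.letin ihM).trans (reds_letin_close _ _)
  | mu J ih => exact ih.mu.trans (reds_mu_muEta _)
  | jmp k M ih =>
    rw [cps_jmp, readback_plug]
    exact (ih.jmp k).trans (simulates_fill_muEta (Ctx.jump k) _).reds

end Expr

end CCV

theorem mainTheorem2 {s : CCV.Cat} (M₁ M₂ : CCV.Exp s) (h : CCV.CcvEq M₁ M₂) :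
    ∃ N : CCV.Exp s, CCV.Reds M₁ N ∧ CCV.Reds M₂ N := by
  obtain ⟨Q, h₁, h₂⟩ := h.conv
  induction M₁ using Quotient.inductionOn with | h A₁ =>
  induction M₂ using Quotient.inductionOn with | h A₂ =>
  exact ⟨CCV.Exp.mk (CCV.Expr.close s (CCV.Cps.readback Q)),
    (CCV.Expr.reds_close_cps A₁).trans (CCV.Cps.Steps.reds_close h₁ s),
    (CCV.Expr.reds_close_cps A₂).trans (CCV.Cps.Steps.reds_close h₂ s)⟩
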